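/- **Setting.** Let $d\ge 1$, $M\ge 1$, and let $b>0$ be such that $b^{-1}$ is an integer with $b^{-1}>2dM$. For $x\in b\mathbb Z^d$ put $Q(x;b,M)=Mx+[0,Mb]^d$. Let $Y=\{Y_z\}_{z\in\mathbb Z^d}$ be an iid family of random elements of a measurable space $S$. For each $x\in b\mathbb Z^d$ let $\mathcal U_x\colon S^{\mathbb Z^d}\to[0,\infty)$ be measurable and let $\mathcal Q_x(\cdot\,;y)$, $y\in S^{\mathbb Z^d}$, be a probability measure on $Q(x;b,M)$ depending measurably on $y$. Assume translation covariance: for all $z_0\in\mathbb Z^d$, $x\in b\mathbb Z^d$ and $y\in S^{\mathbb Z^d}$, $\mathcal U_{x+z_0}(\{y_z\}_z)=\mathcal U_x(\{y_{z+z_0}\}_z)$, and $\mathcal Q_{x+z_0}(\cdot\,;\{y_z\}_z)$ is the translate by $Mz_0$ of $\mathcal Q_x(\cdot\,;\{y_{z+z_0}\}_z)$. Write $\mathcal E_x=\mathcal U_x\mathcal Q_x$; the environment is $\mathcal E=\sum_{x\in b\mathbb Z^d}\mathcal E_x(\cdot\,;Y)$. **Cox process.** Fix a bimeasurable bijection $\Gamma\colon[0,Mb]^d\to[0,1]$.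 Let $\Phi_x(\cdot\,;y)$ be the distribution function of the image under $\Gamma$ of $\mathcal Q_x(\cdot\,;y)$ shifted by $-Mx$, and let $\Phi_x^{-1}(v;y)=\inf\{t\in[0,1]\colon\Phi_x(t;y)\ge v\}$. For $\lambda>0$ let $\{V_x\}_{x\in b\mathbb Z^d}$ be iid Poisson point processes on $[0,1]\times[0,\infty)$ with intensity $\lambda$ (times Lebesgue measure), independent of $Y$, and set $$X^{\mathsf s}=\bigcup_{x\in b\mathbb Z^d}\big\{Mx+\Gamma^{-1}(\Phi_x^{-1}(v;Y))\colon (v,u)\in V_x,\ u\le\mathcal U_x(Y)\big\},$$ a Cox process with intensity measure $\lambda\mathcal E$. Let $\mathbb P_\lambda$ be its law. **Conditions.** For $z\in\mathbb Z^d$ let $I_b(z)=b\mathbb Z^d\cap(z+[0,1)^d)$, $I_b^+(z)=b\mathbb Z^d\cap(z+[-1,2)^d)$, $I_b^{++}(z)=b\mathbb Z^d\cap(z+[-2,3)^d)$. A site $x\in b\mathbb Z^d$ is non-empty if $\mathcal U_x(Y)>0$ and $\eta$-supported if $\mathcal U_x(Y)\ge\eta$; two sites of $b\mathbb Z^d$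 are adjacent if their $\ell^\infty$-distance is $b$. Let $q_0(d)$ be the infimum of all $q\in[0,1]$ such that every 6-dependent site percolation model on the nearest-neighbour lattice $\mathbb Z^d$ all of whose marginal probabilities are at least $q$ has almost surely an infinite open cluster; here 6-dependent means that the restrictions of the model to any two sets of sites at $\ell^\infty$-distance larger than $6$ are independent. Assume: 1. (1-dependence) for all $z\in\mathbb Z^d$ and $x\in I_b(z)$, $\mathcal E_x(\cdot\,;y)=\mathcal E_x(\cdot\,;y')$ whenever $y_w=y'_w$ for all $w\in z+\{-1,0,1\}^d$; 2. (bounded local intensity) there is $\rho>0$ such that almost surely $\mathcal U_x(Y)\le\rho$ for all $x\in b\mathbb Z^d$; 3. (coverage) $\mathbb P(\text{some }x\in I_b(o)\text{ is non-empty})>q_0(d)$; 4. (essential connectedness) there is $\eta>0$ such that almost surely, for every $z\in\mathbb Z^d$, any two non-empty sites $x,x'\in I_b^+(z)$ are connected by a chain of adjacent sites in $I_b^{++}(z)$ all of which, except possibly $x$ and $x'$ themselves, are $\eta$-supported. **Claim.** For $A,B\subset\mathbb R^d$ let $\{A\leftrightsquigarrow B\}$ be the event that some path in the union of the open Euclidean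 balls of radius $1/2$ centred at the points of $X^{\mathsf s}$ joins a point of $A$ to a point of $B$. Let $\Lambda_r=[-r,r]^d$ and $\partial\Lambda_n=\Lambda_{n-M}\setminus\Lambda_{n-2M}$. Then for every $\lambda>0$ the limit $$\theta(\lambda)=\lim_{n\to\infty}\mathbb P_\lambda\big(\Lambda_{3M}\leftrightsquigarrow\partial\Lambda_n\big)$$ exists, and the critical intensity $\lambda_c=\inf\{\lambda>0\colon\theta(\lambda)>0\}$ (with $\inf\varnothing=\infty$) satisfies $$0<\lambda_c<\infty .$$ -/

import Mathlib

open MeasureTheory ProbabilityTheory Filter Topology Set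
open scoped NNReal ENNReal

noncomputable section

namespace CoxPercolation

/-! ### Finitely dependent site percolation on `ℤ^d` -/

/-- The nearest-neighbour graph on `ℤ^d`. -/
def latticeGraph (d : ℕ) : SimpleGraph (Fin d → ℤ) where
  Adj z w := ∑ i, |z i - w i| = 1
  symm := ⟨fun z w h => by simpa only [abs_sub_comm] using h⟩
  loopless := ⟨fun z h => by simp at h⟩

/-- The configuration `ω` (`true` means open) has an infinite connected component of open sites. -/
def SitePercolates {d : ℕ} (ω : (Fin d → ℤ) → Bool) : Prop :=
  ∃ c : ((latticeGraph d).induce {z | ω z = true}).ConnectedComponent, c.supp.Infinite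

/-- `k`-dependence of a random field on `ℤ^d`: its restrictions to any two sets of sites at mutual
`ℓ^∞`-distance larger than `k` are independent. -/
def IsDependent {d : ℕ} (k : ℕ) (μ : Measure ((Fin d → ℤ) → Bool)) : Prop :=
  ∀ A B : Set (Fin d → ℤ), (∀ a ∈ A, ∀ b ∈ B, ∃ i, (k : ℤ) < |a i - b i|) →
    Indep (⨆ z ∈ A, MeasurableSpace.comap (fun ω : (Fin d → ℤ) → Bool => ω z) ⊤)
      (⨆ z ∈ B, MeasurableSpace.comap (fun ω : (Fin d → ℤ) → Bool => ω z) ⊤) μ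

/-- Every 6-dependent site percolation model on `ℤ^d` all of whose marginal probabilities are
at least `q` percolates almost surely. -/
def ForcesPercolation (d : ℕ) (q : ℝ) : Prop :=
  ∀ μ : Measure ((Fin d → ℤ) → Bool), IsProbabilityMeasure μ → IsDependent 6 μ →
    (∀ z, q ≤ μ.real {ω | ω z = true}) → ∀ᵐ ω ∂μ, SitePercolates ω

/-- The threshold `q₀(d)`: the infimum of all `q ∈ [0, 1]` that force percolation of 6-dependent
site percolation models on `ℤ^d`. -/
def q0 (d : ℕ) : ℝ := sInf {q : ℝ | 0 ≤ q ∧ q ≤ 1 ∧ ForcesPercolation d q}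

/-! ### Geometry

Throughout `b = 1 / N`, and a site `x ∈ bℤ^d` is encoded by the integer vector `k = x / b`. -/

/-- The cube `[0, s]^d`. -/
def baseCube (d : ℕ) (s : ℝ) : Set (EuclideanSpace ℝ (Fin d)) := {p | ∀ i, p i ∈ Icc 0 s}

/-- The point `M x` for the site `x = k / N`. -/
def corner {d : ℕ} (M : ℝ) (N : ℕ) (k : Fin d → ℤ) : EuclideanSpace ℝ (Fin d) :=
  WithLp.toLp 2 (fun i => M * ((k i : ℝ) / N))

/-- The cube `Q(x; b, M) = M x + [0, M b]^d`. -/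
def cube {d : ℕ} (M : ℝ) (N : ℕ) (k : Fin d → ℤ) : Set (EuclideanSpace ℝ (Fin d)) :=
  {p | p - corner M N k ∈ baseCube d (M / N)}

/-- `bℤ^d ∩ (z + [-m, m + 1)^d)`: this is `I_b(z)`, `I_b^+(z)`, `I_b^{++}(z)` for `m = 0, 1, 2`. -/
def block {d : ℕ} (N : ℕ) (m : ℤ) (z : Fin d → ℤ) : Set (Fin d → ℤ) :=
  {k | ∀ i, (N : ℤ) * (z i - m) ≤ k i ∧ k i < (N : ℤ) * (z i + m + 1)}

/-- Sites of `bℤ^d` at `d_∞`-distance exactly `b`. -/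
def SiteAdj {d : ℕ} (k l : Fin d → ℤ) : Prop := k ≠ l ∧ ∀ i, |k i - l i| ≤ 1

/-! ### Environments -/

/-- The data `(𝓤_x, 𝓠_x)`, `x ∈ bℤ^d`, of a factor-of-iid environment driven by a family of
elements of `S` indexed by `ℤ^d`. -/
structure FactorEnvironment (d : ℕ) (M : ℝ) (N : ℕ) (S : Type*) [MeasurableSpace S] where
  /-- the total mass `𝓤_x(y) ∈ [0, ∞)` -/
  U : (Fin d → ℤ) → ((Fin d → ℤ) → S) → ℝ≥0
  /-- the probability measure `𝓠_x(·; y)` -/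
  Q : (Fin d → ℤ) → ((Fin d → ℤ) → S) → Measure (EuclideanSpace ℝ (Fin d))
  measurable_U : ∀ k, Measurable (U k)
  measurable_Q : ∀ k, Measurable (Q k)
  prob_Q : ∀ k y, IsProbabilityMeasure (Q k y)
  supp_Q : ∀ k y, Q k y (cube M N k)ᶜ = 0
  /-- `𝓤_{x + z₀}({y_z}_z) = 𝓤_x({y_{z + z₀}}_z)` -/
  cov_U : ∀ k z₀ y, U (fun i => k i + N * z₀ i) y = U k (fun z => y (z + z₀))
  /-- `𝓠_{x + z₀}({y_z}_z)` is `𝓠_x({y_{z + z₀}}_z)` translated by `M z₀` -/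
  cov_Q : ∀ k z₀ y, Q (fun i => k i + N * z₀ i) y =
    (Q k (fun z => y (z + z₀))).map (fun p => p + WithLp.toLp 2 (fun i => M * (z₀ i : ℝ)))

namespace FactorEnvironment

variable {d : ℕ} {M : ℝ} {N : ℕ} {S : Type*} [MeasurableSpace S]

/-- The local environment `𝓔_x = 𝓤_x 𝓠_x`. -/
def localMeasure (E : FactorEnvironment d M N S) (k : Fin d → ℤ) (y : (Fin d → ℤ) → S) :
    Measure (EuclideanSpace ℝ (Fin d)) := E.U k y • E.Q k y

/-- 1-dependence. -/
def OneDependent (E : FactorEnvironment d M N S) : Prop :=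
  ∀ z, ∀ k ∈ block N 0 z, ∀ y y' : (Fin d → ℤ) → S,
    (∀ w, (∀ i, |w i - z i| ≤ 1) → y w = y' w) → E.localMeasure k y = E.localMeasure k y'

variable {Ω : Type*} [MeasurableSpace Ω]

/-- Uniformly bounded local intensity. -/
def BoundedIntensity (E : FactorEnvironment d M N S) (P : Measure Ω)
    (Y : (Fin d → ℤ) → Ω → S) : Prop :=
  ∃ ρ : ℝ≥0, 0 < ρ ∧ ∀ k, ∀ᵐ ω ∂P, E.U k (fun z => Y z ω) ≤ ρ

/-- Coverage: the origin of `ℤ^d` is non-empty with probability larger than `q₀(d)`. -/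
def Coverage (E : FactorEnvironment d M N S) (P : Measure Ω) (Y : (Fin d → ℤ) → Ω → S) : Prop :=
  q0 d < P.real {ω | ∃ k ∈ block N 0 (0 : Fin d → ℤ), 0 < E.U k (fun z => Y z ω)}

/-- Essential connectedness: any two non-empty sites `k, k'` of `I_b^+(z)` are joined by a chain
of adjacent sites all of whose members other than `k, k'` themselves are `η`-supported and
belong to `I_b^{++}(z)`. -/
def EssentiallyConnected (E : FactorEnvironment d M N S) (P : Measure Ω)
    (Y : (Fin d → ℤ) → Ω → S) : Prop :=
  ∃ η : ℝ≥0, 0 < η ∧ ∀ᵐ ω ∂P, ∀ z, ∀ k ∈ block N 1 z, ∀ k' ∈ block N 1 z,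
    0 < E.U k (fun z => Y z ω) → 0 < E.U k' (fun z => Y z ω) →
      Relation.ReflTransGen
        (fun a c => SiteAdj a c ∧ (c = k' ∨ (η ≤ E.U c (fun z => Y z ω) ∧ c ∈ block N 2 z))) k k'

end FactorEnvironment

/-! ### Poisson point processes -/

section Poisson

variable {Ω α : Type*} [MeasurableSpace Ω] [MeasurableSpace α]

/-- The random set `V` is a Poisson point process with (σ-finite, diffuse) intensity `ν`. -/
structure IsPoissonProcess (V : Ω → Set α) (ν : Measure α) (P : Measure Ω) : Prop where
  measurable_count : ∀ B, MeasurableSet B → Measurable fun ω => (V ω ∩ B).encard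
  law_count : ∀ B, MeasurableSet B → ν B < ∞ →
    P.map (fun ω => (V ω ∩ B).encard) =
      (poissonMeasure (ν B).toNNReal).map (fun n : ℕ => (n : ℕ∞))
  indep_count : ∀ (n : ℕ) (B : Fin n → Set α), (∀ i, MeasurableSet (B i)) →
    Pairwise (fun i j => Disjoint (B i) (B j)) → iIndepFun (fun i ω => (V ω ∩ B i).encard) P

/-- The σ-algebra on `Ω` generated by the point process `V`, i.e. by its counts. -/
abbrev processSigma (V : Ω → Set α) : MeasurableSpace Ω :=
  ⨆ (B : Set α) (_ : MeasurableSet B), MeasurableSpace.comap (fun ω => (V ω ∩ B).encard) ⊤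

end Poisson

/-- Lebesgue measure on `[0, 1] × [0, ∞)`. -/
def markVolume : Measure (unitInterval × ℝ≥0) :=
  (volume : Measure unitInterval).prod (((volume : Measure ℝ).restrict (Ici 0)).map Real.toNNReal)

/-! ### The Cox process and its percolation probabilities -/

section Cox

variable {d : ℕ} {M : ℝ} {N : ℕ} {S : Type*} [MeasurableSpace S]

/-- The distribution function `Φ_x(t; y)` of the image of `𝓠_x(·; y)` (shifted to `[0, Mb]^d`)
under `Γ`. -/
def cdfΓ (E : FactorEnvironment d M N S) (Γ : baseCube d (M / N) ≃ᵐ unitInterval)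
    (k : Fin d → ℤ) (y : (Fin d → ℤ) → S) (t : unitInterval) : ℝ :=
  (E.Q k y).real {p | ∃ h : p - corner M N k ∈ baseCube d (M / N), Γ ⟨p - corner M N k, h⟩ ≤ t}

/-- The inverse distribution function `Φ_x^{-1}(v; y)`. -/
def quantileΓ (E : FactorEnvironment d M N S) (Γ : baseCube d (M / N) ≃ᵐ unitInterval)
    (k : Fin d → ℤ) (y : (Fin d → ℤ) → S) (v : unitInterval) : unitInterval :=
  sInf {t : unitInterval | (v : ℝ) ≤ cdfΓ E Γ k y t}

/-- The points `Ψ_x(V_x; y) = {M x + Γ⁻¹(Φ_x⁻¹(v; y)) : (v, u) ∈ V_x, u ≤ 𝓤_x(y)}`. -/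
def localPoints (E : FactorEnvironment d M N S) (Γ : baseCube d (M / N) ≃ᵐ unitInterval)
    (k : Fin d → ℤ) (W : Set (unitInterval × ℝ≥0)) (y : (Fin d → ℤ) → S) :
    Set (EuclideanSpace ℝ (Fin d)) :=
  {p | ∃ w ∈ W, w.2 ≤ E.U k y ∧
    p = corner M N k + (Γ.symm (quantileΓ E Γ k y w.1) : EuclideanSpace ℝ (Fin d))}

/-- The Cox point process `Ψ(V, y) = ⋃_x Ψ_x(V_x; y)`. -/
def coxPoints (E : FactorEnvironment d M N S) (Γ : baseCube d (M / N) ≃ᵐ unitInterval)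
    (W : (Fin d → ℤ) → Set (unitInterval × ℝ≥0)) (y : (Fin d → ℤ) → S) :
    Set (EuclideanSpace ℝ (Fin d)) :=
  ⋃ k, localPoints E Γ k (W k) y

/-- `A ↭ B` in the union of the balls of radius `1/2` centred at the points of `X`. -/
def Connects (X A B : Set (EuclideanSpace ℝ (Fin d))) : Prop :=
  ∃ p ∈ A, ∃ q ∈ B, JoinedIn (⋃ x ∈ X, Metric.ball x (1 / 2)) p q

/-- The box `Λ_r = [-r, r]^d`. -/
def box (d : ℕ) (r : ℝ) : Set (EuclideanSpace ℝ (Fin d)) := {p | ∀ i, |p i| ≤ r}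

/-- `∂Λ_n = Λ_{n - M} \ Λ_{n - 2M}`. -/
def boxBoundary (d : ℕ) (M r : ℝ) : Set (EuclideanSpace ℝ (Fin d)) :=
  box d (r - M) \ box d (r - 2 * M)

variable {Ω : Type*} [MeasurableSpace Ω]

/-- The probability of `Λ_{3M} ↭ ∂Λ_n` in the Cox process built from the families `V` and `Y`. -/
def crossingProb (E : FactorEnvironment d M N S) (Γ : baseCube d (M / N) ≃ᵐ unitInterval)
    (P : Measure Ω) (Y : (Fin d → ℤ) → Ω → S)
    (V : (Fin d → ℤ) → Ω → Set (unitInterval × ℝ≥0)) (n : ℕ) : ℝ≥0∞ :=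
  P {ω | Connects (coxPoints E Γ (fun k => V k ω) (fun z => Y z ω))
    (box d (3 * M)) (boxBoundary d M n)}

/-- The percolation probability `θ = lim_n P(Λ_{3M} ↭ ∂Λ_n)`. -/
def theta (E : FactorEnvironment d M N S) (Γ : baseCube d (M / N) ≃ᵐ unitInterval)
    (P : Measure Ω) (Y : (Fin d → ℤ) → Ω → S)
    (V : (Fin d → ℤ) → Ω → Set (unitInterval × ℝ≥0)) : ℝ≥0∞ :=
  limUnder atTop (crossingProb E Γ P Y V)

/-- The critical intensity `λ_c = inf {l > 0 : θ(l) > 0} ∈ [0, ∞]` (with `inf ∅ = ∞`), where the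
family `V l` drives the model with intensity parameter `l`. -/
def criticalIntensity (E : FactorEnvironment d M N S) (Γ : baseCube d (M / N) ≃ᵐ unitInterval)
    (P : Measure Ω) (Y : (Fin d → ℤ) → Ω → S)
    (V : ℝ≥0 → (Fin d → ℤ) → Ω → Set (unitInterval × ℝ≥0)) : ℝ≥0∞ :=
  sInf {c : ℝ≥0∞ | ∃ l : ℝ≥0, 0 < l ∧ 0 < theta E Γ P Y (V l) ∧ c = l}

end Cox

end CoxPercolation

end

open CoxPercolation

open MeasureTheory ProbabilityTheory Filter Topology Set
open scoped NNReal ENNReal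

namespace CoxPercolation

/-! ### Paths in unions of balls -/

section Geometry

variable {d : ℕ}

/-! Once `5 * M ≤ n`, a path from `Λ_{3M}` to a far annulus crosses every nearer one, so the
crossing probabilities are eventually antitone and converge (`tendsto_crossingProb`). Both bounds on
the critical intensity compare the Cox process with a lattice model built from the events that `V k`
hits the strip `[0, 1] × [0, r]`. These events are independent over sites and have probability `1 -
exp(-l r)`.

Low intensity: almost surely no mass exceeds `ρ`, so a point in the cube of `k` forces `V k` to hit
the strip of height `ρ`. A crossing then yields a long self-avoiding chain of occupied sites with
bounded steps. There are at most constant times `K ^ m` such chains of `m` steps, each fully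
occupied with probability at most `(l ρ) ^ (m + 1)`, so `θ = 0` when `K l ρ ≤ 1/2`
(`theta_eq_zero`).

High intensity: `z` is called good if its cell contains a `δ`-supported site and every site of
`I_b^{++}(z)` is occupied at height `δ`. Essential connectedness, together with the small size of
the cubes, turns a lattice path of good sites into a chain of overlapping balls
(`connects_of_mem_reachSet`). Goodness is a 6-dependent, translation invariant field. For small `δ`
and then large `l`, its marginal exceeds an admissible level for `q0 d`, by the strict inequality in
the coverage condition. Hence good sites percolate and `θ > 0` (`theta_pos`).

Every `l` with `θ(l) > 0` lies above a fixed positive threshold, and one such `l` exists, so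
monotonicity of `θ` in `l` is not needed. Crossing events enter only through inclusions, so their
measurability is not needed either. -/

theorem mem_box_iff_norm {r : ℝ} (hr : 0 ≤ r) (p : EuclideanSpace ℝ (Fin d)) :
    p ∈ box d r ↔ ‖WithLp.ofLp p‖ ≤ r := by
  rw [pi_norm_le_iff_of_nonneg hr]
  rfl

/-- A path in a union of balls yields a chain of overlapping balls. -/
theorem exists_chain_of_joinedIn {X : Set (EuclideanSpace ℝ (Fin d))}
    {p q : EuclideanSpace ℝ (Fin d)} (h : JoinedIn (⋃ x ∈ X, Metric.ball x (1 / 2)) p q) :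
    ∃ x ∈ X, ∃ y ∈ X, dist p x < 1 / 2 ∧ dist q y < 1 / 2 ∧
      Relation.ReflTransGen (fun a c => a ∈ X ∧ c ∈ X ∧ dist a c < 1) x y := by
  obtain ⟨x, hx, hpx⟩ := mem_iUnion₂.1 h.source_mem
  obtain ⟨γ, hγ⟩ := h
  set R : EuclideanSpace ℝ (Fin d) → EuclideanSpace ℝ (Fin d) → Prop :=
    fun a c => a ∈ X ∧ c ∈ X ∧ dist a c < 1
  -- The balls split into those reachable from `x` by overlaps and the rest. The two unions are open
  -- and disjoint, so the connected path stays in the first.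
  set A : Set (EuclideanSpace ℝ (Fin d)) :=
    ⋃ y ∈ {y | y ∈ X ∧ Relation.ReflTransGen R x y}, Metric.ball y (1 / 2)
  set B : Set (EuclideanSpace ℝ (Fin d)) :=
    ⋃ y ∈ {y | y ∈ X ∧ ¬ Relation.ReflTransGen R x y}, Metric.ball y (1 / 2)
  have hA : IsOpen A := isOpen_biUnion fun _ _ => Metric.isOpen_ball
  have hB : IsOpen B := isOpen_biUnion fun _ _ => Metric.isOpen_ball
  have hAB : Disjoint A B := by
    rw [Set.disjoint_left]
    intro w hwA hwB
    obtain ⟨a, ⟨haX, ha⟩, hwa⟩ := mem_iUnion₂.1 hwA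
    obtain ⟨c, ⟨hcX, hc⟩, hwc⟩ := mem_iUnion₂.1 hwB
    refine hc (ha.tail ⟨haX, hcX, ?_⟩)
    rw [Metric.mem_ball] at hwa hwc
    have := dist_triangle_left a c w
    linarith
  have hcover : range γ ⊆ A ∪ B := by
    rintro _ ⟨t, rfl⟩
    obtain ⟨y, hy, hty⟩ := mem_iUnion₂.1 (hγ t)
    by_cases hxy : Relation.ReflTransGen R x y
    · exact Or.inl (mem_iUnion₂.2 ⟨y, ⟨hy, hxy⟩, hty⟩)
    · exact Or.inr (mem_iUnion₂.2 ⟨y, ⟨hy, hxy⟩, hty⟩)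
  have hsub : range γ ⊆ A := by
    refine (isPreconnected_range γ.continuous).subset_left_of_subset_union hA hB hAB hcover ?_
    exact ⟨p, ⟨0, γ.source⟩, mem_iUnion₂.2 ⟨x, ⟨hx, .refl⟩, hpx⟩⟩
  obtain ⟨y, ⟨hy, hxy⟩, hqy⟩ := mem_iUnion₂.1 (hsub ⟨1, γ.target⟩)
  exact ⟨x, hx, y, hy, hpx, hqy, hxy⟩

/-- A chain of overlapping balls yields a path. -/
theorem joinedIn_of_chain {X : Set (EuclideanSpace ℝ (Fin d))}
    {x y : EuclideanSpace ℝ (Fin d)} (hx : x ∈ X)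
    (h : Relation.ReflTransGen (fun a c => c ∈ X ∧ dist a c < 1) x y) :
    y ∈ X ∧ JoinedIn (⋃ x ∈ X, Metric.ball x (1 / 2)) x y := by
  induction h with
  | refl =>
    exact ⟨hx, JoinedIn.refl (mem_iUnion₂.2 ⟨x, hx, Metric.mem_ball_self (by norm_num)⟩)⟩
  | @tail a c _ hac ih =>
    obtain ⟨ha, hxa⟩ := ih
    obtain ⟨hc, hac⟩ := hac
    refine ⟨hc, hxa.trans ?_⟩
    -- Centres at distance below `1` have a midpoint lying in both balls; each ball is convex, so
    -- the path goes through that midpoint.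
    have hma : midpoint ℝ a c ∈ Metric.ball a (1 / 2) := by
      rw [Metric.mem_ball, dist_midpoint_left]
      norm_num; linarith
    have hmc : midpoint ℝ a c ∈ Metric.ball c (1 / 2) := by
      rw [Metric.mem_ball, dist_midpoint_right]
      norm_num; linarith
    have key : ∀ w ∈ X, ∀ u ∈ Metric.ball w (1 / 2), ∀ v ∈ Metric.ball w (1 / 2),
        JoinedIn (⋃ x ∈ X, Metric.ball x (1 / 2)) u v := by
      intro w hw u hu v hv
      refine (((convex_ball w (1 / 2)).isPathConnected ⟨u, hu⟩).joinedIn u hu v hv).mono ?_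
      exact subset_biUnion_of_mem (u := fun w => Metric.ball w (1 / 2)) hw
    exact (key a ha _ (Metric.mem_ball_self (by norm_num)) _ hma).trans
      (key c hc _ hmc _ (Metric.mem_ball_self (by norm_num)))

/-- A path that starts in `Λ_{n - 2M}` and leaves it meets `∂Λ_n`. -/
theorem exists_joinedIn_boxBoundary {U : Set (EuclideanSpace ℝ (Fin d))} {M r : ℝ} (hM : 0 < M)
    (hr : 0 ≤ r - 2 * M) {p q : EuclideanSpace ℝ (Fin d)} (h : JoinedIn U p q)
    (hp : p ∈ box d (r - 2 * M)) (hq : q ∉ box d (r - 2 * M)) :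
    ∃ q' ∈ boxBoundary d M r, JoinedIn U p q' := by
  have hr' : 0 ≤ r - M := by linarith
  by_cases hqM : q ∈ box d (r - M)
  · exact ⟨q, ⟨hqM, hq⟩, h⟩
  obtain ⟨γ, hγ⟩ := h
  rw [mem_box_iff_norm hr] at hp
  rw [mem_box_iff_norm hr', not_le] at hqM
  have hf : Continuous fun t => ‖WithLp.ofLp (γ t)‖ := by fun_prop
  -- The boxes are sup-norm balls, so the intermediate value theorem gives a time at which the path
  -- lies on the outer face of the annulus.
  obtain ⟨t, ht⟩ : r - M ∈ range fun t => ‖WithLp.ofLp (γ t)‖ := by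
    refine mem_range_of_exists_le_of_exists_ge hf ⟨0, ?_⟩ ⟨1, ?_⟩
    · simp only [γ.source]; linarith
    · simp only [γ.target]; linarith
  simp only at ht
  refine ⟨γ t, ⟨?_, ?_⟩, ?_⟩
  · rw [mem_box_iff_norm hr']; exact ht.le
  · rw [mem_box_iff_norm hr]; linarith
  · refine JoinedIn.mono ?_ (range_subset_iff.2 hγ)
    have : PathConnectedSpace unitInterval := isPathConnected_iff_pathConnectedSpace.1
      ((convex_Icc (0 : ℝ) 1).isPathConnected ⟨0, by simp⟩)
    exact (isPathConnected_range γ.continuous).joinedIn _ ⟨0, γ.source⟩ _ ⟨t, rfl⟩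

theorem box_mono {r s : ℝ} (h : r ≤ s) : box d r ⊆ box d s := fun _ hp i => (hp i).trans h

/-- Crossings of a larger annulus contain crossings of a smaller one. -/
theorem Connects.of_le {X : Set (EuclideanSpace ℝ (Fin d))} {M r s : ℝ} (hM : 0 < M)
    (hr : 5 * M ≤ r) (hrs : r ≤ s) (h : Connects X (box d (3 * M)) (boxBoundary d M s)) :
    Connects X (box d (3 * M)) (boxBoundary d M r) := by
  obtain ⟨p, hp, q, hq, hpq⟩ := h
  obtain ⟨q', hq', h'⟩ := exists_joinedIn_boxBoundary (r := r) hM (by linarith) hpq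
    (box_mono (by linarith) hp) (fun h => hq.2 (box_mono (by linarith) h))
  exact ⟨p, hp, q', hq', h'⟩

end Geometry

/-! ### Existence of the limit defining `θ`. -/

section Limit

variable {d : ℕ} {M : ℝ} {N : ℕ} {S : Type*} [MeasurableSpace S] {Ω : Type*} [MeasurableSpace Ω]
  (E : FactorEnvironment d M N S) (Γ : baseCube d (M / N) ≃ᵐ unitInterval)
  (P : Measure Ω) (Y : (Fin d → ℤ) → Ω → S) (V : (Fin d → ℤ) → Ω → Set (unitInterval × ℝ≥0))

theorem crossingProb_anti (hM : 0 < M) {m n : ℕ} (hm : 5 * M ≤ m) (hmn : m ≤ n) :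
    crossingProb E Γ P Y V n ≤ crossingProb E Γ P Y V m :=
  measure_mono fun _ h => Connects.of_le hM hm (by exact_mod_cast hmn) h

/-- Monotonicity holds only from `5 * M` on, where `Λ_{3M}` lies inside `Λ_{n-2M}`, hence the shift
by `m`. Since `theta` is a `limUnder`, every bound on it passes through this convergence. -/
theorem tendsto_crossingProb (hM : 0 < M) :
    Tendsto (crossingProb E Γ P Y V) atTop (𝓝 (theta E Γ P Y V)) := by
  apply tendsto_nhds_limUnder
  obtain ⟨m, hm⟩ := exists_nat_ge (5 * M)
  have hanti : Antitone fun n => crossingProb E Γ P Y V (n + m) := fun a c hac =>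
    crossingProb_anti E Γ P Y V hM (hm.trans (by push_cast; linarith [(Nat.cast_nonneg a : (0 : ℝ) ≤ a)]))
      (by omega)
  exact ⟨_, (tendsto_add_atTop_iff_nat m).1 (tendsto_atTop_iInf hanti)⟩

end Limit

/-! ### Points of the Cox process -/

section Points

variable {d : ℕ} {M : ℝ} {N : ℕ} {S : Type*} [MeasurableSpace S]
  {E : FactorEnvironment d M N S} {Γ : baseCube d (M / N) ≃ᵐ unitInterval}

theorem mem_cube_of_mem_localPoints {k : Fin d → ℤ} {W : Set (unitInterval × ℝ≥0)}
    {y : (Fin d → ℤ) → S} {p : EuclideanSpace ℝ (Fin d)} (h : p ∈ localPoints E Γ k W y) :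
    p ∈ cube M N k := by
  obtain ⟨w, -, -, rfl⟩ := h
  simp only [cube, mem_ofPred_eq, add_sub_cancel_left]
  exact Subtype.coe_prop _

theorem mem_cube_iff {k : Fin d → ℤ} {p : EuclideanSpace ℝ (Fin d)} :
    p ∈ cube M N k ↔ ∀ i, M * ((k i : ℝ) / N) ≤ p i ∧ p i ≤ M * ((k i : ℝ) / N) + M / N := by
  simp only [cube, baseCube, corner, mem_ofPred_eq, mem_Icc, PiLp.sub_apply, sub_nonneg]
  refine forall_congr' fun i => and_congr_right fun _ => ?_
  rw [sub_le_iff_le_add']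

/-- The strip `[0, 1] × [0, r]`. -/
def strip (r : ℝ≥0) : Set (unitInterval × ℝ≥0) := univ ×ˢ Iic r

/-- This and `localPoints_nonempty` sandwich the presence of Cox points between events of `V k`
alone: an upper bound on the mass gives a necessary condition, a lower bound a sufficient one. -/
theorem inter_strip_nonempty_of_mem_localPoints {k : Fin d → ℤ} {W : Set (unitInterval × ℝ≥0)}
    {y : (Fin d → ℤ) → S} {p : EuclideanSpace ℝ (Fin d)} (h : p ∈ localPoints E Γ k W y)
    {r : ℝ≥0} (hr : E.U k y ≤ r) : (W ∩ strip r).Nonempty := by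
  obtain ⟨w, hw, hwu, -⟩ := h
  exact ⟨w, hw, mem_univ _, hwu.trans hr⟩

theorem localPoints_nonempty {k : Fin d → ℤ} {W : Set (unitInterval × ℝ≥0)}
    {y : (Fin d → ℤ) → S} {r : ℝ≥0} (hr : r ≤ E.U k y) (h : (W ∩ strip r).Nonempty) :
    (localPoints E Γ k W y).Nonempty := by
  obtain ⟨w, hw, -, hwr⟩ := h
  exact ⟨_, w, hw, le_trans hwr hr, rfl⟩

/-- Points in the cubes of two adjacent sites have distance less than `1`. -/
theorem dist_lt_one_of_siteAdj (hd : 1 ≤ d) (hM : 1 ≤ M) (hN : 2 * (d : ℝ) * M < N)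
    {k l : Fin d → ℤ} (hkl : SiteAdj k l) {p q : EuclideanSpace ℝ (Fin d)}
    (hp : p ∈ cube M N k) (hq : q ∈ cube M N l) : dist p q < 1 := by
  rw [mem_cube_iff] at hp hq
  have hd' : (1 : ℝ) ≤ d := by exact_mod_cast hd
  have hN0 : (0 : ℝ) < N := by nlinarith
  -- Adjacent cubes of side `M / N` differ by at most `2 * (M / N) < 1 / d` in each coordinate, so
  -- the squared Euclidean distance is below `d * (1 / d) ^ 2 = 1 / d ≤ 1`.
  have hs : M / N < 1 / (2 * d) := by
    rw [div_lt_div_iff₀ hN0 (by positivity)]; linarith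
  have hs0 : 0 < M / N := by positivity
  have hcoord : ∀ i, |p i - q i| ≤ 2 * (M / N) := by
    intro i
    have h1 : |(k i : ℝ) - l i| ≤ 1 := by exact_mod_cast hkl.2 i
    have h2 : M * ((k i : ℝ) / N) - M * ((l i : ℝ) / N) = (M / N) * (k i - l i) := by ring
    have h3 := abs_le.1 h1
    obtain ⟨a1, a2⟩ := hp i
    obtain ⟨b1, b2⟩ := hq i
    rw [abs_le]
    constructor <;> nlinarith
  rw [EuclideanSpace.dist_eq, Real.sqrt_lt' one_pos]
  calc ∑ i, dist (p i) (q i) ^ 2 ≤ ∑ _i : Fin d, (2 * (M / N)) ^ 2 := by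
        refine Finset.sum_le_sum fun i _ => ?_
        rw [Real.dist_eq]
        exact pow_le_pow_left₀ (abs_nonneg _) (hcoord i) 2
    _ = d * (2 * (M / N)) ^ 2 := by simp
    _ < d * (2 * (1 / (2 * d))) ^ 2 := by gcongr
    _ = 1 / d := by field_simp
    _ ≤ 1 ^ 2 := by rw [one_pow, div_le_one (by positivity)]; exact hd'

/-- The sites of two points at distance less than `1` are close to each other. -/
theorem abs_sub_le_of_dist_lt_one (hM : 1 ≤ M) (hN : 0 < N)
    {k l : Fin d → ℤ} {p q : EuclideanSpace ℝ (Fin d)}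
    (hp : p ∈ cube M N k) (hq : q ∈ cube M N l) (hpq : dist p q < 1) (i : Fin d) :
    |k i - l i| ≤ N + 1 := by
  rw [mem_cube_iff] at hp hq
  have hN0 : (0 : ℝ) < N := by exact_mod_cast hN
  have h1 : |p i - q i| < 1 := by
    refine lt_of_le_of_lt ?_ hpq
    rw [dist_eq_norm]
    exact PiLp.norm_apply_le (p - q) i
  obtain ⟨a1, a2⟩ := hp i
  obtain ⟨b1, b2⟩ := hq i
  have h2 : M * ((k i : ℝ) / N) - M * ((l i : ℝ) / N) = (M / N) * (k i - l i) := by ring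
  have hs0 : 0 < M / N := by positivity
  have h3 : 1 ≤ (M / N) * N := by rw [div_mul_cancel₀ _ hN0.ne']; exact hM
  have h4 := abs_lt.1 h1
  -- In units of the cube side, a distance below `1` counts for at most `N` since `1 ≤ M = (M / N) *
  -- N`; the extra `1` is the width of a cube.
  have h5 : |(k i : ℝ) - l i| ≤ N + 1 := by
    rw [abs_le]
    constructor
    · by_contra hc; push Not at hc
      nlinarith [mul_lt_mul_of_pos_left hc hs0]
    · by_contra hc; push Not at hc
      nlinarith [mul_lt_mul_of_pos_left hc hs0]
  exact_mod_cast h5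

end Points

/-! ### Void probabilities of the Poisson processes -/

section Void

variable {Ω : Type*} [MeasurableSpace Ω] {P : Measure Ω}

theorem measurableSet_strip (r : ℝ≥0) : MeasurableSet (strip r) :=
  MeasurableSet.univ.prod measurableSet_Iic

theorem markVolume_strip (r : ℝ≥0) : markVolume (strip r) = r := by
  have h : Real.toNNReal ⁻¹' Iic r ∩ Ici 0 = Icc 0 (r : ℝ) := by
    ext x
    simp only [mem_inter_iff, mem_preimage, mem_Iic, mem_Ici, mem_Icc, Real.toNNReal_le_iff_le_coe]
    tauto
  rw [markVolume, strip, Measure.prod_prod, measure_univ, one_mul,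
    Measure.map_apply measurable_real_toNNReal measurableSet_Iic,
    Measure.restrict_apply (measurable_real_toNNReal measurableSet_Iic), h, Real.volume_Icc,
    sub_zero, ENNReal.ofReal_coe_nnreal]

/-- Measurability is with respect to `processSigma W`, not the ambient σ-algebra, so that
independence of the processes carries over to occupation events. -/
theorem measurableSet_inter_nonempty {Ω α : Type*} [MeasurableSpace α] (W : Ω → Set α)
    {B : Set α} (hB : MeasurableSet B) : MeasurableSet[processSigma W] {ω | (W ω ∩ B).Nonempty} := by
  have h : MeasurableSet[MeasurableSpace.comap (fun ω => (W ω ∩ B).encard) ⊤]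
      {ω | (W ω ∩ B).Nonempty} := by
    refine ⟨{0}ᶜ, trivial, ?_⟩
    ext ω
    simp [Set.nonempty_iff_ne_empty]
  exact le_iSup₂ (f := fun (B : Set α) (_ : MeasurableSet B) =>
    MeasurableSpace.comap (fun ω => (W ω ∩ B).encard) ⊤) B hB _ h

theorem IsPoissonProcess.processSigma_le {α : Type*} [MeasurableSpace α] {W : Ω → Set α}
    {ν : Measure α} (h : IsPoissonProcess W ν P) : processSigma W ≤ ‹MeasurableSpace Ω› :=
  iSup₂_le fun B hB => (h.measurable_count B hB).comap_le

theorem IsPoissonProcess.measure_strip_empty {W : Ω → Set (unitInterval × ℝ≥0)} {l : ℝ≥0}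
    (h : IsPoissonProcess W (l • markVolume) P) (r : ℝ≥0) :
    P {ω | (W ω ∩ strip r).Nonempty}ᶜ = ENNReal.ofReal (Real.exp (-(l * r))) := by
  have hν : (l • markVolume) (strip r) = ((l * r : ℝ≥0) : ℝ≥0∞) := by
    rw [Measure.smul_apply, markVolume_strip, ENNReal.smul_def, smul_eq_mul, ENNReal.coe_mul]
  have hlaw := h.law_count (strip r) (measurableSet_strip r) (by rw [hν]; exact ENNReal.coe_lt_top)
  rw [hν, ENNReal.toNNReal_coe] at hlaw
  have h0 := congrArg (fun μ => μ {0}) hlaw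
  rw [Measure.map_apply (h.measurable_count _ (measurableSet_strip r)) (.of_discrete),
    Measure.map_apply (.of_discrete) (.of_discrete)] at h0
  have e1 : {ω | (W ω ∩ strip r).Nonempty}ᶜ = (fun ω => (W ω ∩ strip r).encard) ⁻¹' {0} := by
    ext ω
    simp [Set.not_nonempty_iff_eq_empty]
  have e2 : (fun n : ℕ => (n : ℕ∞)) ⁻¹' {0} = {0} := by
    ext n; simp
  rw [e1, h0, e2, poissonMeasure_singleton]
  simp

/-- The exact value is `1 - exp(-l r)`; the linear bound makes chain probabilities small as `l`
decreases. -/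
theorem IsPoissonProcess.measure_strip_nonempty_le [IsProbabilityMeasure P]
    {W : Ω → Set (unitInterval × ℝ≥0)} {l : ℝ≥0}
    (h : IsPoissonProcess W (l • markVolume) P) (r : ℝ≥0) :
    P {ω | (W ω ∩ strip r).Nonempty} ≤ ((l * r : ℝ≥0) : ℝ≥0∞) := by
  have hm : MeasurableSet {ω | (W ω ∩ strip r).Nonempty} :=
    h.processSigma_le _ (measurableSet_inter_nonempty W (measurableSet_strip r))
  have h1 := prob_compl_eq_one_sub (μ := P) hm.compl
  rw [compl_compl, h.measure_strip_empty r, ← ENNReal.ofReal_one,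
    ← ENNReal.ofReal_sub _ (Real.exp_pos _).le] at h1
  rw [h1, ← ENNReal.ofReal_coe_nnreal]
  refine ENNReal.ofReal_le_ofReal ?_
  have := Real.add_one_le_exp (-((l : ℝ) * r))
  push_cast
  linarith

end Void

/-! ### Counting self-avoiding chains -/

section Peierls

variable {d : ℕ}

/-- The position after `j` steps of the chain with starting point `k` and increments `s`. -/
def chainOfSteps {m : ℕ} (k : Fin d → ℤ) (s : Fin m → Fin d → ℤ) (j : ℕ) : Fin d → ℤ :=
  k + ∑ i ∈ Finset.range j, if h : i < m then s ⟨i, h⟩ else 0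

theorem chainOfSteps_sub (v : ℕ → Fin d → ℤ) {m j : ℕ} (hj : j ≤ m) :
    chainOfSteps (v 0) (fun i : Fin m => v (i + 1) - v i) j = v j := by
  have h : ∑ i ∈ Finset.range j, (if _h : i < m then v (i + 1) - v i else 0) =
      ∑ i ∈ Finset.range j, (v (i + 1) - v i) :=
    Finset.sum_congr rfl fun i hi => dif_pos ((Finset.mem_range.1 hi).trans_le hj)
  simp only [chainOfSteps]
  rw [h, Finset.sum_range_sub, add_sub_cancel]

/-- The union bound over self-avoiding chains of length `m` with steps of size at most `R`. -/
theorem measure_exists_chain_le {Ω : Type*} [MeasurableSpace Ω] {P : Measure Ω}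
    {O : (Fin d → ℤ) → Set Ω} {p : ℝ≥0∞}
    (hO : ∀ T : Finset (Fin d → ℤ), P (⋂ k ∈ T, O k) ≤ p ^ T.card)
    (R m : ℕ) (B : Finset (Fin d → ℤ)) :
    P {ω | ∃ v : ℕ → Fin d → ℤ, v 0 ∈ B ∧ (∀ i < m, ∀ j, |v (i + 1) j - v i j| ≤ R) ∧
      InjOn v (Iic m) ∧ ∀ i ≤ m, ω ∈ O (v i)} ≤
      B.card * (((2 * R + 1) ^ d : ℕ) : ℝ≥0∞) ^ m * p ^ (m + 1) := by
  classical
  set D : Finset (Fin d → ℤ) := Fintype.piFinset fun _ => Finset.Icc (-(R : ℤ)) R with hD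
  have hcard : D.card = (2 * R + 1) ^ d := by
    rw [hD, Fintype.card_piFinset]
    simp only [Int.card_Icc, Finset.prod_const, Finset.card_univ, Fintype.card_fin]
    congr 1
    omega
  set I : Finset ((Fin d → ℤ) × (Fin m → Fin d → ℤ)) := B ×ˢ Fintype.piFinset fun _ => D with hI
  have hIcard : I.card = B.card * ((2 * R + 1) ^ d) ^ m := by
    rw [hI, Finset.card_product, Fintype.card_piFinset]
    simp [hcard]
  set A : (Fin d → ℤ) × (Fin m → Fin d → ℤ) → Set Ω := fun c =>
    {ω | InjOn (chainOfSteps c.1 c.2) (Iic m) ∧ ∀ i ≤ m, ω ∈ O (chainOfSteps c.1 c.2 i)} with hA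
  have hbound : ∀ c ∈ I, P (A c) ≤ p ^ (m + 1) := by
    intro c _
    -- A self-avoiding chain visits `m + 1` distinct sites, which gives the full power of `p`;
    -- otherwise the event is empty.
    by_cases hinj : InjOn (chainOfSteps c.1 c.2) (Iic m)
    · have hT : ((Finset.range (m + 1)).image (chainOfSteps c.1 c.2)).card = m + 1 := by
        rw [Finset.card_image_of_injOn, Finset.card_range]
        intro a ha e he hae
        exact hinj (by simpa using ha) (by simpa using he) hae
      calc P (A c) ≤ P (⋂ k ∈ (Finset.range (m + 1)).image (chainOfSteps c.1 c.2), O k) := by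
            refine measure_mono fun ω hω => ?_
            simp only [Finset.mem_image, Finset.mem_range, mem_iInter]
            rintro k ⟨i, hi, rfl⟩
            exact hω.2 i (by omega)
        _ ≤ _ := (hO _).trans (by rw [hT])
    · have : A c = ∅ := by
        ext ω
        simp only [hA, mem_ofPred_eq, mem_empty_iff_false, iff_false]
        exact fun h => hinj h.1
      simp [this]
  calc _ ≤ P (⋃ c ∈ I, A c) := by
        refine measure_mono ?_
        rintro ω ⟨v, hv0, hstep, hinj, hopen⟩
        refine mem_iUnion₂.2 ⟨(v 0, fun i : Fin m => v (i + 1) - v i), ?_, ?_, ?_⟩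
        · simp only [hI, hD, Finset.mem_product, Fintype.mem_piFinset, Finset.mem_Icc]
          exact ⟨hv0, fun i j => abs_le.1 (hstep i i.2 j)⟩
        · intro a ha e he hae
          simp only at hae
          rw [chainOfSteps_sub v ha, chainOfSteps_sub v he] at hae
          exact hinj ha he hae
        · intro i hi
          simp only
          rw [chainOfSteps_sub v hi]
          exact hopen i hi
    _ ≤ ∑ c ∈ I, P (A c) := measure_biUnion_finset_le _ _
    _ ≤ I.card • p ^ (m + 1) := Finset.sum_le_card_nsmul _ _ _ hbound
    _ = _ := by rw [hIcard, nsmul_eq_mul]; push_cast; ring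

/-- A chain with steps of size at most `R` between two occupied sites at distance at least `m R`
contains the first `m` steps of a self-avoiding one. -/
theorem exists_injOn_chain {o : (Fin d → ℤ) → Prop} {R m : ℕ} {k l : Fin d → ℤ} (hk : o k)
    (h : Relation.ReflTransGen (fun a c => o c ∧ ∀ i, |a i - c i| ≤ R) k l) {i : Fin d}
    (hi : (m * R : ℤ) ≤ |l i - k i|) (hR : 0 < R) :
    ∃ v : ℕ → Fin d → ℤ, v 0 = k ∧ (∀ i < m, ∀ j, |v (i + 1) j - v i j| ≤ R) ∧
      InjOn v (Iic m) ∧ ∀ i ≤ m, o (v i) := by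
  -- Loops are erased by passing to a path in the graph of occupied sites. Each edge moves
  -- coordinate `i` by at most `R`, so this path has at least `m` edges.
  let G : SimpleGraph (Fin d → ℤ) :=
    { Adj := fun a c => a ≠ c ∧ o a ∧ o c ∧ ∀ i, |a i - c i| ≤ R
      symm := ⟨fun a c h => ⟨h.1.symm, h.2.2.1, h.2.1, fun i => abs_sub_comm (a i) (c i) ▸ h.2.2.2 i⟩⟩
      loopless := ⟨fun a h => h.1 rfl⟩ }
  have hreach : o l ∧ G.Reachable k l := by
    clear hi
    induction h with
    | refl => exact ⟨hk, .refl _⟩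
    | @tail a c _ hac ih =>
      refine ⟨hac.1, ih.2.trans ?_⟩
      by_cases hne : a = c
      · rw [hne]
      · exact SimpleGraph.Adj.reachable ⟨hne, ih.1, hac.1, hac.2⟩
  obtain ⟨p, hp⟩ := hreach.2.exists_isPath
  have hlen : ∀ {u w : Fin d → ℤ} (p : G.Walk u w), |w i - u i| ≤ p.length * R := by
    intro u w p
    induction p with
    | nil => simp
    | @cons u v w h p ih =>
      have h1 := h.2.2.2 i
      have h2 : |w i - u i| ≤ |w i - v i| + |u i - v i| := by
        rw [abs_sub_comm (u i)]; exact abs_sub_le _ _ _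
      rw [SimpleGraph.Walk.length_cons]
      push_cast
      linarith
  have hml : m ≤ p.length := by
    have h1 : (m * R : ℤ) ≤ p.length * R := hi.trans (hlen p)
    have h2 : (0 : ℤ) < R := by exact_mod_cast hR
    exact_mod_cast le_of_mul_le_mul_right h1 h2
  have hopen : ∀ {u w : Fin d → ℤ} (p : G.Walk u w), o u → ∀ i, o (p.getVert i) := by
    intro u w p
    induction p with
    | nil => intro hu i; simpa using hu
    | cons h p ih =>
      intro hu i
      cases i with
      | zero => simpa using hu
      | succ i => simpa using ih h.2.2.1 i
  refine ⟨p.getVert, p.getVert_zero, fun j hj i => ?_, ?_, fun i _ => hopen p hk i⟩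
  · have := (p.adj_getVert_succ (hj.trans_le hml)).2.2.2 i
    rwa [abs_sub_comm] at this
  · exact hp.getVert_injOn.mono fun a (ha : a ≤ m) => ha.trans hml

end Peierls

/-! ### Absence of percolation at low intensity -/

section Subcritical

variable {d : ℕ} {M : ℝ} {N : ℕ} {S : Type*} [MeasurableSpace S]
  {E : FactorEnvironment d M N S} {Γ : baseCube d (M / N) ≃ᵐ unitInterval}

/-- A crossing yields a chain of occupied sites. -/
theorem Connects.exists_siteChain (hM : 1 ≤ M) (hMN : M ≤ N)
    {W : (Fin d → ℤ) → Set (unitInterval × ℝ≥0)} {y : (Fin d → ℤ) → S} {ρ : ℝ≥0}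
    (hρ : ∀ k, E.U k y ≤ ρ) {r : ℝ} (hr : 0 ≤ r)
    (h : Connects (coxPoints E Γ W y) (box d (3 * M)) (boxBoundary d M r)) :
    ∃ k l : Fin d → ℤ, (∀ i, |k i| ≤ 5 * N) ∧ (∃ i, r - 4 * N ≤ |(l i : ℝ)|) ∧
      (W k ∩ strip ρ).Nonempty ∧
      Relation.ReflTransGen (fun a c => (W c ∩ strip ρ).Nonempty ∧
        ∀ i, |a i - c i| ≤ ((N + 1 : ℕ) : ℤ)) k l := by
  obtain ⟨p, hp, q, hq, hpq⟩ := h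
  obtain ⟨x, hx, x', hx', hpx, hqx, hchain⟩ := exists_chain_of_joinedIn hpq
  have hN0 : (0 : ℝ) < N := by linarith
  have hN : 0 < N := by exact_mod_cast hN0
  have hs0 : 0 < M / N := by positivity
  have hs1 : M / N ≤ 1 := (div_le_one hN0).2 hMN
  have hsN : M / N * N = M := div_mul_cancel₀ _ hN0.ne'
  have hcoord : ∀ {u v : EuclideanSpace ℝ (Fin d)}, dist u v < 1 / 2 → ∀ i, |u i - v i| < 1 / 2 := by
    intro u v huv i
    refine lt_of_le_of_lt ?_ huv
    rw [dist_eq_norm]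
    exact PiLp.norm_apply_le (u - v) i
  obtain ⟨k, hk⟩ := mem_iUnion.1 hx
  have hlift : ∃ l, x' ∈ localPoints E Γ l (W l) y ∧
      Relation.ReflTransGen (fun a c => (W c ∩ strip ρ).Nonempty ∧
        ∀ i, |a i - c i| ≤ ((N + 1 : ℕ) : ℤ)) k l := by
    clear hqx hx'
    induction hchain with
    | refl => exact ⟨k, hk, .refl⟩
    | @tail a c _ hac ih =>
      obtain ⟨j, hj, hkj⟩ := ih
      obtain ⟨l, hl⟩ := mem_iUnion.1 hac.2.1
      refine ⟨l, hl, hkj.tail ⟨inter_strip_nonempty_of_mem_localPoints hl (hρ l), fun i => ?_⟩⟩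
      push_cast
      exact abs_sub_le_of_dist_lt_one hM hN (mem_cube_of_mem_localPoints hj)
        (mem_cube_of_mem_localPoints hl) hac.2.2 i
  obtain ⟨l, hl, hkl⟩ := hlift
  refine ⟨k, l, fun i => ?_, ?_, inter_strip_nonempty_of_mem_localPoints hk (hρ k), hkl⟩
  · have h1 := abs_lt.1 (hcoord hpx i)
    have h2 := abs_le.1 (hp i)
    have h3 := mem_cube_iff.1 (mem_cube_of_mem_localPoints hk) i
    have h4 : M * ((k i : ℝ) / N) = M / N * k i := by ring
    rw [h4] at h3
    -- The corner of the cube has coordinates of size at most `3M + 1/2 + M/N ≤ 3M + 3/2 ≤ 5M`, and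
    -- `5M` is `5N` cube sides.
    have h5 : |(k i : ℝ)| ≤ 5 * N := by
      rw [abs_le]
      constructor
      · by_contra hc; push Not at hc
        nlinarith [mul_lt_mul_of_pos_left hc hs0]
      · by_contra hc; push Not at hc
        nlinarith [mul_lt_mul_of_pos_left hc hs0]
    exact_mod_cast h5
  · have hq2 : ∃ i, r - 2 * M < |q i| := by
      by_contra hc
      push Not at hc
      exact hq.2 hc
    obtain ⟨i, hi⟩ := hq2
    refine ⟨i, ?_⟩
    have h1 := abs_lt.1 (hcoord hqx i)
    have h3 := mem_cube_iff.1 (mem_cube_of_mem_localPoints hl) i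
    have h4 : M * ((l i : ℝ) / N) = M / N * l i := by ring
    rw [h4] at h3
    -- If `|l i| < r - 4N`, the corner has `i`-th coordinate below `r - 4M` in size. Adding `1/2`
    -- for the ball and at most `1` for the cube gives `|q i| < r - 2M`, contradicting the choice of
    -- `i`.
    by_contra hc
    push Not at hc
    have h5 := mul_lt_mul_of_pos_left hc hs0
    have h6 : M / N * (r - 4 * N) ≤ r - 4 * M := by nlinarith
    have h7 : |q i| ≤ |M / N * (l i : ℝ)| + 3 / 2 := by
      rw [abs_le]
      constructor
      · linarith [neg_abs_le (M / N * (l i : ℝ))]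
      · linarith [le_abs_self (M / N * (l i : ℝ))]
    rw [abs_mul, abs_of_pos hs0] at h7
    linarith

variable {Ω : Type*} [MeasurableSpace Ω] {P : Measure Ω} [IsProbabilityMeasure P]
  {Y : (Fin d → ℤ) → Ω → S} {V : (Fin d → ℤ) → Ω → Set (unitInterval × ℝ≥0)}

/-- The percolation probability vanishes at low intensity. -/
theorem theta_eq_zero (hM : 1 ≤ M) (hMN : M ≤ N) {l ρ : ℝ≥0}
    (hV : ∀ k, IsPoissonProcess (V k) (l • markVolume) P)
    (hVindep : iIndep (fun k => processSigma (V k)) P)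
    (hρ : ∀ k, ∀ᵐ ω ∂P, E.U k (fun z => Y z ω) ≤ ρ)
    (hl : ((2 * (N + 1) + 1) ^ d : ℕ) * (l * ρ) ≤ 1 / 2) :
    theta E Γ P Y V = 0 := by
  classical
  set K : ℕ := (2 * (N + 1) + 1) ^ d with hK
  set B : Finset (Fin d → ℤ) := Fintype.piFinset fun _ => Finset.Icc (-(5 * N : ℤ)) (5 * N) with hB
  set p : ℝ≥0∞ := ((l * ρ : ℝ≥0) : ℝ≥0∞) with hp
  have hO : ∀ T : Finset (Fin d → ℤ),
      P (⋂ k ∈ T, {ω | (V k ω ∩ strip ρ).Nonempty}) ≤ p ^ T.card := by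
    intro T
    rw [hVindep.meas_biInter fun k _ =>
      measurableSet_inter_nonempty (V k) (measurableSet_strip ρ)]
    exact Finset.prod_le_pow_card _ _ _ fun k _ => (hV k).measure_strip_nonempty_le ρ
  have hKp : (K : ℝ≥0∞) * p ≤ 2⁻¹ := by
    have : ((K * (l * ρ) : ℝ≥0) : ℝ≥0∞) ≤ ((1 / 2 : ℝ≥0) : ℝ≥0∞) := by exact_mod_cast hl
    simpa [hp] using this
  have hp1 : p ≤ 1 := by
    have h1 : (1 : ℝ≥0∞) ≤ K := by
      have : 1 ≤ K := Nat.one_le_iff_ne_zero.2 (by positivity)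
      exact_mod_cast this
    calc p ≤ K * p := by simpa using mul_le_mul_left h1 p
      _ ≤ 2⁻¹ := hKp
      _ ≤ 1 := by simp
  have hbound : ∀ m : ℕ, theta E Γ P Y V ≤ B.card * 2⁻¹ ^ m := by
    intro m
    refine le_of_tendsto (tendsto_crossingProb E Γ P Y V (by linarith)) ?_
    -- The `9 * N` absorbs the offsets `5 * N` and `4 * N` of the two end sites, leaving room for
    -- `m` steps of size `N + 1`.
    filter_upwards [eventually_ge_atTop (m * (N + 1) + 9 * N)] with n hn
    calc crossingProb E Γ P Y V n ≤ _ := ?_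
      _ ≤ _ := measure_exists_chain_le hO (N + 1) m B
      _ = B.card * (K * p) ^ m * p := by rw [← hK]; ring
      _ ≤ B.card * 2⁻¹ ^ m * 1 := by gcongr
      _ = _ := mul_one _
    refine measure_mono_ae ?_
    filter_upwards [ae_all_iff.2 hρ] with ω hω hcross
    obtain ⟨k, k', hk, ⟨i, hi⟩, hko, hkk'⟩ :=
      Connects.exists_siteChain hM hMN hω (Nat.cast_nonneg n) hcross
    have hi' : (n : ℤ) - 4 * N ≤ |k' i| := by exact_mod_cast hi
    have hdist : (m * (N + 1 : ℕ) : ℤ) ≤ |k' i - k i| := by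
      have h1 := abs_sub_abs_le_abs_sub (k' i) (k i)
      have h2 := hk i
      have h3 : ((m * (N + 1) + 9 * N : ℕ) : ℤ) ≤ n := by exact_mod_cast hn
      push_cast at h3 ⊢
      linarith
    obtain ⟨v, hv0, hstep, hinj, hopen⟩ := exists_injOn_chain
      (o := fun k => (V k ω ∩ strip ρ).Nonempty) hko hkk' hdist (Nat.succ_pos N)
    refine ⟨v, ?_, hstep, hinj, hopen⟩
    simp only [hv0, hB, Fintype.mem_piFinset, Finset.mem_Icc]
    exact fun i => abs_le.1 (hk i)
  have hlim : Tendsto (fun m : ℕ => (B.card : ℝ≥0∞) * 2⁻¹ ^ m) atTop (𝓝 (B.card * 0)) :=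
    ENNReal.Tendsto.const_mul (ENNReal.tendsto_pow_atTop_nhds_zero_of_lt_one (by simp))
      (Or.inr (ENNReal.natCast_ne_top _))
  rw [mul_zero] at hlim
  exact le_antisymm (ge_of_tendsto' hlim hbound) zero_le

end Subcritical

/-! ### Lattice percolation -/

section Lattice

variable {d : ℕ}

theorem measurableSet_apply_eq_true (z : Fin d → ℤ) :
    MeasurableSet {c : (Fin d → ℤ) → Bool | c z = true} :=
  (measurable_pi_apply (X := fun _ : Fin d → ℤ => Bool) z) (measurableSet_singleton true)

/-- One step of an exploration of the open cluster of a site. -/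
def OpenStep (c : (Fin d → ℤ) → Bool) (a b : Fin d → ℤ) : Prop :=
  (latticeGraph d).Adj a b ∧ c b = true

/-- The configurations in which the open cluster of `z` contains a site at distance more than
`m` from `z`. -/
def reachSet (m : ℕ) (z : Fin d → ℤ) : Set ((Fin d → ℤ) → Bool) :=
  {c | c z = true ∧ ∃ w, (∃ i, (m : ℤ) < |w i - z i|) ∧ Relation.ReflTransGen (OpenStep c) z w}

/-- Being reachable in exactly `n` steps is measurable by induction on `n`, through a countable
union over the last intermediate site; reachability is the union over `n`. -/
theorem measurableSet_reflTransGen_openStep (z w : Fin d → ℤ) :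
    MeasurableSet {c : (Fin d → ℤ) → Bool | Relation.ReflTransGen (OpenStep c) z w} := by
  let T : ℕ → (Fin d → ℤ) → Set ((Fin d → ℤ) → Bool) := fun n =>
    Nat.rec (fun w => {_c | w = z})
      (fun _ T w => ⋃ a, T a ∩ ({_c | (latticeGraph d).Adj a w} ∩ {c | c w = true})) n
  have hT : ∀ n w, MeasurableSet (T n w) := by
    intro n
    induction n with
    | zero => exact fun w => MeasurableSet.const _
    | succ n ih =>
      intro w
      refine MeasurableSet.iUnion fun a => (ih a).inter ((MeasurableSet.const _).inter ?_)
      exact measurableSet_apply_eq_true w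
  have heq : {c | Relation.ReflTransGen (OpenStep c) z w} = ⋃ n, T n w := by
    ext c
    simp only [mem_ofPred_eq, mem_iUnion]
    constructor
    · intro h
      induction h with
      | refl => exact ⟨0, rfl⟩
      | @tail a b _ hab ih =>
        obtain ⟨n, hn⟩ := ih
        exact ⟨n + 1, mem_iUnion.2 ⟨a, hn, hab.1, hab.2⟩⟩
    · rintro ⟨n, hn⟩
      induction n generalizing w with
      | zero => obtain rfl : w = z := hn; exact .refl
      | succ n ih =>
        obtain ⟨a, ha, h1, h2⟩ := mem_iUnion.1 hn
        exact (ih a ha).tail ⟨h1, h2⟩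
  rw [heq]
  exact MeasurableSet.iUnion fun n => hT n w

theorem measurableSet_reachSet (m : ℕ) (z : Fin d → ℤ) : MeasurableSet (reachSet m z) := by
  have h : reachSet m z = {c | c z = true} ∩ ⋃ w, {_c | ∃ i, (m : ℤ) < |w i - z i|} ∩
      {c | Relation.ReflTransGen (OpenStep c) z w} := by
    ext c
    simp [reachSet]
  rw [h]
  refine MeasurableSet.inter (measurableSet_apply_eq_true z) ?_
  exact MeasurableSet.iUnion fun w =>
    (MeasurableSet.const _).inter (measurableSet_reflTransGen_openStep z w)

theorem mem_reachSet_shift {m : ℕ} {z : Fin d → ℤ} {c : (Fin d → ℤ) → Bool}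
    (h : c ∈ reachSet m z) : (fun w => c (w + z)) ∈ reachSet m 0 := by
  obtain ⟨hz, w, ⟨i, hi⟩, hw⟩ := h
  refine ⟨by simpa using hz, w - z, ⟨i, by simpa using hi⟩, ?_⟩
  have := hw.lift (p := OpenStep fun w => c (w + z)) (fun a => a - z) (fun a b hab => ?_)
  · simpa [Function.onFun] using this
  · refine ⟨?_, ?_⟩
    · have h1 : ∑ i, |a i - b i| = 1 := hab.1
      change ∑ i, |(a - z) i - (b - z) i| = 1
      simpa using h1
    · simpa using hab.2

/-- An infinite cluster escapes every finite box. One site `z` serves all radii, so percolation is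
covered by countably many measurable events indexed by `z`. -/
theorem SitePercolates.exists_forall_mem_reachSet {c : (Fin d → ℤ) → Bool}
    (h : SitePercolates c) : ∃ z, ∀ m, c ∈ reachSet m z := by
  obtain ⟨C, hC⟩ := h
  obtain ⟨z, hz⟩ := hC.nonempty
  refine ⟨z, fun m => ⟨z.2, ?_⟩⟩
  have hfin : {w : {z | c z = true} | ∀ i, |w.1 i - z.1 i| ≤ m}.Finite := by
    refine Set.Finite.preimage (f := Subtype.val) Subtype.val_injective.injOn
      (s := {w : Fin d → ℤ | ∀ i, |w i - z.1 i| ≤ m}) ?_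
    refine (Set.Finite.pi' fun i => Set.finite_Icc (z.1 i - m) (z.1 i + m)).subset ?_
    intro w hw i
    have := abs_le.1 (hw i)
    constructor <;> linarith
  obtain ⟨w, hwC, hw⟩ := hC.exists_notMem_finite hfin
  have hw' : ∃ i, (m : ℤ) < |w.1 i - z.1 i| := by
    by_contra hc
    push Not at hc
    exact hw hc
  refine ⟨w.1, hw', ?_⟩
  have hzw : ((latticeGraph d).induce {z | c z = true}).Reachable z w :=
    SimpleGraph.ConnectedComponent.exact (hz.trans hwC.symm)
  rw [SimpleGraph.reachable_iff_reflTransGen] at hzw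
  exact hzw.lift Subtype.val fun a b hab => ⟨hab, b.2⟩

theorem sitePercolates_of_forall (hd : 1 ≤ d) {c : (Fin d → ℤ) → Bool} (h : ∀ z, c z = true) :
    SitePercolates c := by
  let e : ℕ → {z | c z = true} := fun n => ⟨Pi.single ⟨0, hd⟩ (n : ℤ), h _⟩
  have hinj : Function.Injective e := by
    intro a b hab
    have := congrFun (congrArg Subtype.val hab) ⟨0, hd⟩
    simpa [e] using this
  refine ⟨((latticeGraph d).induce {z | c z = true}).connectedComponentMk (e 0), ?_⟩
  refine (Set.infinite_range_of_injective hinj).mono ?_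
  rintro _ ⟨n, rfl⟩
  induction n with
  | zero => rfl
  | succ n ih =>
    refine Eq.trans (SimpleGraph.ConnectedComponent.sound (SimpleGraph.Adj.reachable ?_)) ih
    change ∑ i, |(Pi.single ⟨0, hd⟩ ((n + 1 : ℕ) : ℤ) : Fin d → ℤ) i -
      (Pi.single ⟨0, hd⟩ (n : ℤ) : Fin d → ℤ) i| = 1
    rw [Finset.sum_eq_single ⟨0, hd⟩]
    · simp
    · intro i _ hi
      simp [hi]
    · simp

/-- This makes the set defining `q0` nonempty, so that its `sInf` is a genuine infimum. At level `1`
almost surely every site is open, and a coordinate half-line gives the infinite cluster. -/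
theorem forcesPercolation_one (hd : 1 ≤ d) : ForcesPercolation d 1 := by
  intro μ hμ _ hq
  have h : ∀ z, ∀ᵐ ω ∂μ, ω z = true := by
    intro z
    refine (mem_ae_iff_prob_eq_one (measurableSet_apply_eq_true z)).2 ?_
    refine le_antisymm prob_le_one ?_
    have h1 := hq z
    rw [measureReal_def] at h1
    rw [← ENNReal.ofReal_one]
    exact ENNReal.ofReal_le_of_le_toReal h1
  filter_upwards [ae_all_iff.2 h] with ω hω
  exact sitePercolates_of_forall hd hω

/-- The infimum itself need not be admissible. A level strictly below `p` also leaves room for the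
losses from replacing non-empty by `δ`-supported and from vacant strips. -/
theorem exists_forcesPercolation_lt (hd : 1 ≤ d) {p : ℝ} (hp : q0 d < p) :
    ∃ q < p, ForcesPercolation d q := by
  have hne : {q : ℝ | 0 ≤ q ∧ q ≤ 1 ∧ ForcesPercolation d q}.Nonempty :=
    ⟨1, zero_le_one, le_rfl, forcesPercolation_one hd⟩
  obtain ⟨q, hq, hqp⟩ := exists_lt_of_csInf_lt hne hp
  exact ⟨q, hqp, hq.2.2⟩

end Lattice

/-! ### Independence -/

section Independence

variable {Ω : Type*} {mΩ : MeasurableSpace Ω} {P : Measure Ω}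

/-- Intersections of one event from each factor form a generating π-system. On these the probability
splits into four factors, first across the pairs and then within each pair, and the factors can be
regrouped. Here `m` stands for the environment and `n` for the Poisson processes. -/
theorem indep_sup_sup [IsProbabilityMeasure P] {m₁ m₂ n₁ n₂ : MeasurableSpace Ω}
    (hm₁ : m₁ ≤ mΩ) (hm₂ : m₂ ≤ mΩ) (hn₁ : n₁ ≤ mΩ) (hn₂ : n₂ ≤ mΩ)
    (hm : Indep m₁ m₂ P) (hn : Indep n₁ n₂ P) (h : Indep (m₁ ⊔ m₂) (n₁ ⊔ n₂) P) :
    Indep (m₁ ⊔ n₁) (m₂ ⊔ n₂) P := by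
  have hgen : ∀ m n : MeasurableSpace Ω, m ⊔ n = MeasurableSpace.generateFrom
      (image2 (· ∩ ·) {s | MeasurableSet[m] s} {s | MeasurableSet[n] s}) := by
    intro m n
    refine le_antisymm (sup_le (fun s hs => ?_) fun s hs => ?_)
      (MeasurableSpace.generateFrom_le ?_)
    · exact MeasurableSpace.measurableSet_generateFrom
        ⟨s, hs, univ, @MeasurableSet.univ Ω n, inter_univ s⟩
    · exact MeasurableSpace.measurableSet_generateFrom
        ⟨univ, @MeasurableSet.univ Ω m, s, hs, univ_inter s⟩
    · rintro _ ⟨s, hs, t, ht, rfl⟩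
      exact @MeasurableSet.inter Ω (m ⊔ n) _ _ ((le_sup_left : m ≤ m ⊔ n) _ hs)
        ((le_sup_right : n ≤ m ⊔ n) _ ht)
  have hpi : ∀ m n : MeasurableSpace Ω, IsPiSystem
      (image2 (· ∩ ·) {s | MeasurableSet[m] s} {s | MeasurableSet[n] s}) := by
    rintro m n _ ⟨s, hs, t, ht, rfl⟩ _ ⟨s', hs', t', ht', rfl⟩ -
    exact ⟨s ∩ s', @MeasurableSet.inter Ω m _ _ hs hs', t ∩ t',
      @MeasurableSet.inter Ω n _ _ ht ht', (inter_inter_inter_comm _ _ _ _).symm⟩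
  refine IndepSets.indep (sup_le hm₁ hn₁) (sup_le hm₂ hn₂) (hpi m₁ n₁) (hpi m₂ n₂)
    (hgen m₁ n₁) (hgen m₂ n₂) ?_
  rw [IndepSets_iff]
  rintro _ _ ⟨s, hs, t, ht, rfl⟩ ⟨s', hs', t', ht', rfl⟩
  have l₁ : m₁ ≤ m₁ ⊔ m₂ := le_sup_left
  have l₂ : m₂ ≤ m₁ ⊔ m₂ := le_sup_right
  have r₁ : n₁ ≤ n₁ ⊔ n₂ := le_sup_left
  have r₂ : n₂ ≤ n₁ ⊔ n₂ := le_sup_right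
  rw [Indep_iff] at hm hn h
  simp only
  rw [inter_inter_inter_comm, h _ _ (@MeasurableSet.inter Ω (m₁ ⊔ m₂) _ _ (l₁ _ hs) (l₂ _ hs'))
    (@MeasurableSet.inter Ω (n₁ ⊔ n₂) _ _ (r₁ _ ht) (r₂ _ ht')), hm _ _ hs hs', hn _ _ ht ht',
    h _ _ (l₁ _ hs) (r₁ _ ht), h _ _ (l₂ _ hs') (r₂ _ ht')]
  ring

/-- Independence of σ-algebras under an image measure. -/
theorem indep_map {β : Type*} {m₁ m₂ : MeasurableSpace β} {mβ : MeasurableSpace β} {f : Ω → β}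
    (hf : Measurable f) (hm₁ : m₁ ≤ mβ) (hm₂ : m₂ ≤ mβ)
    (h : Indep (m₁.comap f) (m₂.comap f) P) : Indep m₁ m₂ (P.map f) := by
  rw [Indep_iff] at h ⊢
  intro s t hs ht
  rw [Measure.map_apply hf ((hm₁ _ hs).inter (hm₂ _ ht)), Measure.map_apply hf (hm₁ _ hs),
    Measure.map_apply hf (hm₂ _ ht)]
  exact h _ _ ⟨s, hs, rfl⟩ ⟨t, ht, rfl⟩

/-- The law of an iid family is invariant under injective reindexing. -/
theorem map_reindex_eq [IsProbabilityMeasure P] {ι β : Type*} [MeasurableSpace β] {X : ι → Ω → β}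
    (hX : ∀ i, Measurable (X i)) (hindep : iIndepFun X P) {μ : Measure β}
    (hlaw : ∀ i, P.map (X i) = μ) {g : ι → ι} (hg : g.Injective) :
    P.map (fun ω i => X (g i) ω) = P.map fun ω i => X i ω := by
  rw [(hindep.precomp hg).map_fun_eq_infinitePi_map fun i => hX (g i),
    hindep.map_fun_eq_infinitePi_map hX]
  simp only [hlaw]

end Independence

/-! ### The renormalised site percolation model -/

section Renormalisation

variable {d : ℕ} {M : ℝ} {N : ℕ} {S : Type*} [MeasurableSpace S]
  {E : FactorEnvironment d M N S} {δ : ℝ≥0}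

/-- A site `z` of `ℤ^d` is good if it contains a `δ`-supported site and all sites of
`I_b^{++}(z)` are occupied. -/
def GoodSite (E : FactorEnvironment d M N S) (δ : ℝ≥0)
    (c : ((Fin d → ℤ) → S) × ((Fin d → ℤ) → Prop)) (z : Fin d → ℤ) : Prop :=
  (∃ k ∈ block N 0 z, δ ≤ E.U k c.1) ∧ ∀ k ∈ block N 2 z, c.2 k

open Classical in
/-- The configuration of good sites. -/
noncomputable def goodField (E : FactorEnvironment d M N S) (δ : ℝ≥0)
    (c : ((Fin d → ℤ) → S) × ((Fin d → ℤ) → Prop)) (z : Fin d → ℤ) : Bool :=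
  decide (GoodSite E δ c z)

theorem goodField_eq_true {c : ((Fin d → ℤ) → S) × ((Fin d → ℤ) → Prop)} {z : Fin d → ℤ} :
    goodField E δ c z = true ↔ GoodSite E δ c z := by
  simp [goodField]

/-- Measurability of goodness of a site, with respect to any σ-algebra that makes the relevant
variables measurable. -/
theorem measurableSet_goodSite {Ω : Type*} {mΩ : MeasurableSpace Ω}
    {f : Ω → ((Fin d → ℤ) → S) × ((Fin d → ℤ) → Prop)} {z : Fin d → ℤ}
    (hU : ∀ k ∈ block N 0 z, Measurable fun ω => E.U k (f ω).1)
    (hO : ∀ k ∈ block N 2 z, MeasurableSet {ω | (f ω).2 k}) :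
    MeasurableSet {ω | GoodSite E δ (f ω) z} := by
  have h : {ω | GoodSite E δ (f ω) z} = (⋃ k ∈ block N 0 z, {ω | δ ≤ E.U k (f ω).1}) ∩
      ⋂ k ∈ block N 2 z, {ω | (f ω).2 k} := by
    ext ω
    simp [GoodSite]
  rw [h]
  refine MeasurableSet.inter ?_ (MeasurableSet.biInter (to_countable _) hO)
  exact MeasurableSet.biUnion (to_countable _) fun k hk => hU k hk measurableSet_Ici

theorem measurable_goodField : Measurable (goodField E δ) := by
  refine measurable_pi_iff.2 fun z => measurable_to_bool ?_
  have h : (fun c => goodField E δ c z) ⁻¹' {true} = {c | GoodSite E δ (id c) z} := by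
    ext c
    simp [goodField_eq_true]
  rw [h]
  refine measurableSet_goodSite (fun k _ => (E.measurable_U k).comp measurable_fst) fun k _ => ?_
  exact measurableSet_setOfPred.2 ((measurable_pi_apply k).comp measurable_snd)

theorem mem_block_add {m : ℤ} {k z z₀ : Fin d → ℤ} :
    (fun i => k i + N * z₀ i) ∈ block N m (z + z₀) ↔ k ∈ block N m z := by
  simp only [block, mem_ofPred_eq, Pi.add_apply]
  refine forall_congr' fun i => ?_
  constructor <;> rintro ⟨h1, h2⟩ <;> constructor <;> linarith

/-- Covariance of the configuration of good sites. -/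
theorem goodField_shift (c : ((Fin d → ℤ) → S) × ((Fin d → ℤ) → Prop)) (z z₀ : Fin d → ℤ) :
    goodField E δ (fun w => c.1 (w + z₀), fun k => c.2 fun i => k i + N * z₀ i) z =
      goodField E δ c (z + z₀) := by
  have hsurj : ∀ k : Fin d → ℤ, ∃ k' : Fin d → ℤ, k = fun i => k' i + N * z₀ i :=
    fun k => ⟨fun i => k i - N * z₀ i, by simp⟩
  rw [Bool.eq_iff_iff, goodField_eq_true, goodField_eq_true]
  refine and_congr ⟨?_, ?_⟩ ⟨?_, ?_⟩
  · rintro ⟨k, hk, h⟩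
    exact ⟨_, mem_block_add.2 hk, by rwa [E.cov_U]⟩
  · rintro ⟨k, hk, h⟩
    obtain ⟨k, rfl⟩ := hsurj k
    exact ⟨k, mem_block_add.1 hk, by rwa [E.cov_U] at h⟩
  · intro h k hk
    obtain ⟨k, rfl⟩ := hsurj k
    exact h k (mem_block_add.1 hk)
  · intro h k hk
    exact h _ (mem_block_add.2 hk)

/-- One-dependence concerns the local measure; since `Q` is a probability, evaluation at `univ`
recovers the mass. -/
theorem U_congr (h1 : E.OneDependent) {z k : Fin d → ℤ} (hk : k ∈ block N 0 z)
    {y y' : (Fin d → ℤ) → S} (h : ∀ w, (∀ i, |w i - z i| ≤ 1) → y w = y' w) :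
    E.U k y = E.U k y' := by
  have hm := congrArg (fun μ => μ univ) (h1 z k hk y y' h)
  have := E.prob_Q k y
  have := E.prob_Q k y'
  simp only [FactorEnvironment.localMeasure, Measure.smul_apply, measure_univ, ENNReal.smul_def,
    smul_eq_mul, mul_one] at hm
  exact_mod_cast hm

theorem block_finite (m : ℤ) (z : Fin d → ℤ) : (block N m z).Finite := by
  refine (Set.Finite.pi' fun i => Set.finite_Ico ((N : ℤ) * (z i - m))
    ((N : ℤ) * (z i + m + 1))).subset fun k hk i => hk i

theorem block_mono {m n : ℤ} (hmn : m ≤ n) (z : Fin d → ℤ) : block N m z ⊆ block N n z := by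
  intro k hk i
  have hN : (0 : ℤ) ≤ N := Int.natCast_nonneg N
  obtain ⟨h1, h2⟩ := hk i
  constructor <;> nlinarith

end Renormalisation

/-! ### Stationarity and finite dependence of the good sites. -/

section Law

variable {d : ℕ} {M : ℝ} {N : ℕ} {S : Type*} [MeasurableSpace S]
  {E : FactorEnvironment d M N S} {δ : ℝ≥0}
  {Ω : Type*} [MeasurableSpace Ω] {P : Measure Ω}
  {Y : (Fin d → ℤ) → Ω → S} {V : (Fin d → ℤ) → Ω → Set (unitInterval × ℝ≥0)} {l : ℝ≥0}

/-- The environment variables together with the occupation variables at height `δ`. -/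
def drivingField (Y : (Fin d → ℤ) → Ω → S) (V : (Fin d → ℤ) → Ω → Set (unitInterval × ℝ≥0))
    (δ : ℝ≥0) (ω : Ω) : ((Fin d → ℤ) → S) × ((Fin d → ℤ) → Prop) :=
  (fun z => Y z ω, fun k => (V k ω ∩ strip δ).Nonempty)

theorem measurable_occupied (hV : ∀ k, IsPoissonProcess (V k) (l • markVolume) P)
    (k : Fin d → ℤ) : Measurable fun ω => (V k ω ∩ strip δ).Nonempty :=
  measurableSet_setOfPred.1
    ((hV k).processSigma_le _ (measurableSet_inter_nonempty (V k) (measurableSet_strip δ)))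

theorem measurable_drivingField (hY : ∀ z, Measurable (Y z))
    (hV : ∀ k, IsPoissonProcess (V k) (l • markVolume) P) : Measurable (drivingField Y V δ) :=
  (measurable_pi_iff.2 hY).prodMk (measurable_pi_iff.2 (measurable_occupied hV))

/-- The right-hand side does not mention `k`: this is the identical distribution that
`map_reindex_eq` requires. -/
theorem map_occupied_eq (hV : ∀ k, IsPoissonProcess (V k) (l • markVolume) P)
    (k : Fin d → ℤ) : P.map (fun ω => (V k ω ∩ strip δ).Nonempty) =
      ((poissonMeasure ((l • markVolume) (strip δ)).toNNReal).map (fun n : ℕ => (n : ℕ∞))).map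
        (fun n => n ≠ 0) := by
  rw [← (hV k).law_count (strip δ) (measurableSet_strip δ), Measure.map_map .of_discrete
    ((hV k).measurable_count _ (measurableSet_strip δ))]
  · congr 1
    ext ω
    simp [Set.nonempty_iff_ne_empty]
  · rw [Measure.smul_apply, markVolume_strip, ENNReal.smul_def, smul_eq_mul, ← ENNReal.coe_mul]
    exact ENNReal.coe_lt_top

/-- The law of the driving variables is invariant under the translations of `ℤ^d`. -/
theorem map_drivingField_shift [IsProbabilityMeasure P] (hY : ∀ z, Measurable (Y z))
    (hYindep : iIndepFun Y P) (hYident : ∀ z, IdentDistrib (Y z) (Y 0) P P)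
    (hV : ∀ k, IsPoissonProcess (V k) (l • markVolume) P)
    (hVindep : iIndep (fun k => processSigma (V k)) P)
    (hVY : Indep (⨆ k, processSigma (V k)) (⨆ z, MeasurableSpace.comap (Y z) inferInstance) P)
    (z₀ : Fin d → ℤ) :
    P.map (fun ω => ((fun w => (drivingField Y V δ ω).1 (w + z₀),
      fun k => (drivingField Y V δ ω).2 fun i => k i + N * z₀ i) :
        ((Fin d → ℤ) → S) × ((Fin d → ℤ) → Prop))) = P.map (drivingField Y V δ) := by
  have hO : ∀ k, Measurable fun ω => (V k ω ∩ strip δ).Nonempty := measurable_occupied hV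
  have hOindep : iIndepFun (fun k ω => (V k ω ∩ strip δ).Nonempty) P := by
    refine iIndep_of_iIndep_of_le hVindep fun k => ?_
    exact Measurable.comap_le ((@measurableSet_setOfPred _ (processSigma (V k)) _).1
      (measurableSet_inter_nonempty (V k) (measurableSet_strip δ)))
  have hindep : IndepFun (fun ω z => Y z ω) (fun ω k => (V k ω ∩ strip δ).Nonempty) P := by
    refine indep_of_indep_of_le hVY.symm ?_ ?_
    · refine Measurable.comap_le ((@measurable_pi_iff _ _ _ (_) _ _).2 fun z => ?_)
      exact (comap_measurable (Y z)).mono (le_iSup (fun z => MeasurableSpace.comap (Y z) _) z) le_rfl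
    · refine Measurable.comap_le ((@measurable_pi_iff _ _ _ (_) _ _).2 fun k =>
        (@measurableSet_setOfPred _ (_) _).1 ?_)
      exact le_iSup (fun k => processSigma (V k)) k _
        (measurableSet_inter_nonempty (V k) (measurableSet_strip δ))
  have hYm : Measurable fun ω z => Y z ω := measurable_pi_iff.2 hY
  have hOm : Measurable fun ω k => (V k ω ∩ strip δ).Nonempty := measurable_pi_iff.2 hO
  have hg : Measurable fun (y : (Fin d → ℤ) → S) w => y (w + z₀) :=
    measurable_pi_iff.2 fun w => measurable_pi_apply _
  have hh : Measurable fun (o : (Fin d → ℤ) → Prop) (k : Fin d → ℤ) => o fun i => k i + N * z₀ i :=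
    measurable_pi_iff.2 fun k => measurable_pi_apply _
  have hinjY : Function.Injective fun w : Fin d → ℤ => w + z₀ := add_left_injective z₀
  have hinjO : Function.Injective fun (k : Fin d → ℤ) (i : Fin d) => k i + N * z₀ i := by
    intro a b hab
    funext i
    simpa using congrFun hab i
  have e1 := (indepFun_iff_map_prod_eq_prod_map_map hYm.aemeasurable hOm.aemeasurable).1 hindep
  have e2 := (indepFun_iff_map_prod_eq_prod_map_map (hg.comp hYm).aemeasurable
    (hh.comp hOm).aemeasurable).1 (hindep.comp hg hh)
  refine Eq.trans e2 (Eq.trans ?_ e1.symm)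
  congr 1
  · exact map_reindex_eq hY hYindep (fun z => (hYident z).map_eq) hinjY
  · exact map_reindex_eq hO hOindep (map_occupied_eq hV) hinjO

/-- The configuration of good sites is 6-dependent. -/
theorem isDependent_goodField [IsProbabilityMeasure P] (hY : ∀ z, Measurable (Y z)) (hN : 0 < N)
    (hYindep : iIndepFun Y P) (hV : ∀ k, IsPoissonProcess (V k) (l • markVolume) P)
    (hVindep : iIndep (fun k => processSigma (V k)) P)
    (hVY : Indep (⨆ k, processSigma (V k)) (⨆ z, MeasurableSpace.comap (Y z) inferInstance) P)
    (h1 : E.OneDependent) :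
    IsDependent 6 (P.map fun ω => goodField E δ (drivingField Y V δ ω)) := by
  classical
  intro A B hAB
  have hF : Measurable fun ω => goodField E δ (drivingField Y V δ ω) :=
    measurable_goodField.comp (measurable_drivingField hY hV)
  let nbhd : Set (Fin d → ℤ) → Set (Fin d → ℤ) := fun A => {w | ∃ a ∈ A, ∀ i, |w i - a i| ≤ 1}
  let blocks : Set (Fin d → ℤ) → Set (Fin d → ℤ) := fun A => {k | ∃ a ∈ A, k ∈ block N 2 a}
  let σY : Set (Fin d → ℤ) → MeasurableSpace Ω := fun A =>
    ⨆ w ∈ nbhd A, MeasurableSpace.comap (Y w) inferInstance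
  let σV : Set (Fin d → ℤ) → MeasurableSpace Ω := fun A => ⨆ k ∈ blocks A, processSigma (V k)
  have hσY : ∀ A, σY A ≤ ⨆ z, MeasurableSpace.comap (Y z) inferInstance :=
    fun A => iSup₂_le fun w _ => le_iSup (fun z => MeasurableSpace.comap (Y z) inferInstance) w
  have hσV : ∀ A, σV A ≤ ⨆ k, processSigma (V k) :=
    fun A => iSup₂_le fun w _ => le_iSup (fun k => processSigma (V k)) w
  have hYle : ∀ z, MeasurableSpace.comap (Y z) inferInstance ≤ ‹MeasurableSpace Ω› :=
    fun z => (hY z).comap_le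
  have hVle : ∀ k, processSigma (V k) ≤ ‹MeasurableSpace Ω› := fun k => (hV k).processSigma_le
  have hσY' : ∀ A, σY A ≤ ‹MeasurableSpace Ω› := fun A => iSup₂_le fun w _ => hYle w
  have hσV' : ∀ A, σV A ≤ ‹MeasurableSpace Ω› := fun A => iSup₂_le fun k _ => hVle k
  -- Goodness at `a` reads `Y` within distance `1` of `a` and the processes in `block N 2 a`. Both
  -- kinds of region are disjoint for sites more than `6` apart.
  have hdisjY : Disjoint (nbhd A) (nbhd B) := by
    rw [Set.disjoint_left]
    rintro w ⟨a, ha, haw⟩ ⟨b, hb, hbw⟩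
    obtain ⟨i, hi⟩ := hAB a ha b hb
    have h1 := abs_le.1 (haw i)
    have h2 := abs_le.1 (hbw i)
    have h3 : |a i - b i| ≤ 2 := abs_le.2 ⟨by linarith, by linarith⟩
    push_cast at hi
    linarith
  have hdisjV : Disjoint (blocks A) (blocks B) := by
    rw [Set.disjoint_left]
    rintro k ⟨a, ha, hak⟩ ⟨b, hb, hbk⟩
    obtain ⟨i, hi⟩ := hAB a ha b hb
    have hN' : (0 : ℤ) < N := by exact_mod_cast hN
    have h1 := hak i
    have h2 := hbk i
    have h3 : a i - 2 < b i + 2 + 1 := lt_of_mul_lt_mul_left (h1.1.trans_lt h2.2) hN'.le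
    have h4 : b i - 2 < a i + 2 + 1 := lt_of_mul_lt_mul_left (h2.1.trans_lt h1.2) hN'.le
    have h5 : |a i - b i| ≤ 5 := abs_le.2 ⟨by linarith, by linarith⟩
    push_cast at hi
    linarith
  have hgen : ∀ A : Set (Fin d → ℤ),
      (⨆ z ∈ A, MeasurableSpace.comap (fun ω : (Fin d → ℤ) → Bool => ω z) ⊤).comap
        (fun ω => goodField E δ (drivingField Y V δ ω)) ≤ σY A ⊔ σV A := by
    intro A
    simp only [MeasurableSpace.comap_iSup, MeasurableSpace.comap_comp]
    refine iSup₂_le fun a ha => Measurable.comap_le (m₂ := ⊤) ?_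
    refine @measurable_to_bool _ (σY A ⊔ σV A) _ ?_
    have heq : (fun ω => goodField E δ (drivingField Y V δ ω) a) ⁻¹' {true} =
        {ω | GoodSite E δ (drivingField Y V δ ω) a} := by
      ext ω
      simp [goodField_eq_true]
    refine Eq.mpr (congrArg _ heq) ?_
    refine @measurableSet_goodSite d M N S _ E δ Ω (σY A ⊔ σV A) _ a (fun k hk => ?_) fun k hk => ?_
    · have hΩ : Nonempty Ω := P.nonempty_of_neZero
      obtain ⟨ω₀⟩ := hΩ
      -- Freezing the variables outside the neighbourhood at a fixed sample `ω₀` leaves `U`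
      -- unchanged and exhibits it as a function of the nearby variables only.
      have hU : (fun ω => E.U k (drivingField Y V δ ω).1) = fun ω => E.U k fun w =>
          if ∀ i, |w i - a i| ≤ 1 then Y w ω else Y w ω₀ := by
        funext ω
        refine U_congr h1 hk fun w hw => ?_
        rw [if_pos hw]
        rfl
      rw [hU]
      refine (E.measurable_U k).comp ?_
      refine @measurable_pi_iff _ _ _ (σY A ⊔ σV A) _ _ |>.2 fun w => ?_
      by_cases hw : ∀ i, |w i - a i| ≤ 1
      · simp only [if_pos hw]
        refine (comap_measurable (Y w)).mono (le_trans ?_ le_sup_left) le_rfl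
        exact le_iSup₂ (f := fun w (_ : w ∈ nbhd A) =>
          MeasurableSpace.comap (Y w) inferInstance) w ⟨a, ha, hw⟩
      · simp only [if_neg hw]
        exact @measurable_const _ _ _ (σY A ⊔ σV A) _
    · refine (le_sup_right : σV A ≤ σY A ⊔ σV A) _ ?_
      exact le_iSup₂ (f := fun k (_ : k ∈ blocks A) => processSigma (V k)) k ⟨a, ha, hk⟩ _
        (measurableSet_inter_nonempty (V k) (measurableSet_strip δ))
  have hpi : ∀ A : Set (Fin d → ℤ),
      (⨆ z ∈ A, MeasurableSpace.comap (fun ω : (Fin d → ℤ) → Bool => ω z) ⊤) ≤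
        MeasurableSpace.pi :=
    fun A => iSup₂_le fun z _ => (measurable_pi_apply z).comap_le
  refine indep_map hF (hpi A) (hpi B) (indep_of_indep_of_le ?_ (hgen A) (hgen B))
  refine indep_sup_sup (hσY' A) (hσY' B) (hσV' A) (hσV' B)
    (indep_iSup_of_disjoint hYle hYindep hdisjY) (indep_iSup_of_disjoint hVle hVindep hdisjV) ?_
  exact indep_of_indep_of_le hVY.symm (sup_le (hσY A) (hσY B)) (sup_le (hσV A) (hσV B))

end Law

/-! ### Percolation at high intensity -/

section Crossing

variable {d : ℕ} {M : ℝ} {N : ℕ} {S : Type*} [MeasurableSpace S]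
  {E : FactorEnvironment d M N S} {Γ : baseCube d (M / N) ≃ᵐ unitInterval}

/-- An open path of good sites gives a crossing of the Cox process. -/
theorem connects_of_mem_reachSet (hd : 1 ≤ d) (hM : 1 ≤ M) (hN : 2 * (d : ℝ) * M < N)
    {W : (Fin d → ℤ) → Set (unitInterval × ℝ≥0)} {y : (Fin d → ℤ) → S} {δ η : ℝ≥0} (hδ : 0 < δ)
    (hδη : δ ≤ η)
    (hconn : ∀ z, ∀ k ∈ block N 1 z, ∀ k' ∈ block N 1 z, 0 < E.U k y → 0 < E.U k' y →
      Relation.ReflTransGen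
        (fun a c => SiteAdj a c ∧ (c = k' ∨ (η ≤ E.U c y ∧ c ∈ block N 2 z))) k k')
    {n : ℕ} (hn : 5 * M ≤ n)
    (h : goodField E δ (y, fun k => (W k ∩ strip δ).Nonempty) ∈ reachSet n 0) :
    Connects (coxPoints E Γ W y) (box d (3 * M)) (boxBoundary d M n) := by
  obtain ⟨h0, z, ⟨i, hi⟩, hz⟩ := h
  rw [goodField_eq_true] at h0
  have hd' : (1 : ℝ) ≤ d := by exact_mod_cast hd
  have hN0 : (0 : ℝ) < N := by nlinarith
  have hN' : (0 : ℤ) < N := by exact_mod_cast hN0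
  have hcell : ∀ {z k : Fin d → ℤ} {x : EuclideanSpace ℝ (Fin d)}, k ∈ block N 0 z →
      x ∈ cube M N k → ∀ i, M * z i ≤ x i ∧ x i ≤ M * (z i + 1) := by
    intro z k x hk hx i
    obtain ⟨h1, h2⟩ := mem_cube_iff.1 hx i
    obtain ⟨h3, h4⟩ := hk i
    have h5 : (N : ℝ) * z i ≤ k i := by
      have : (N : ℤ) * z i ≤ k i := by simpa using h3
      exact_mod_cast this
    have h6 : (k i : ℝ) + 1 ≤ N * (z i + 1) := by
      have : k i + 1 ≤ (N : ℤ) * (z i + 1) := by simpa using h4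
      exact_mod_cast this
    have hs : 0 < M / N := by positivity
    have h7 : M * ((k i : ℝ) / N) = M / N * k i := by ring
    have h8 : M / N * (N * z i) = M * z i := by field_simp
    have h9 : M / N * (N * (z i + 1)) = M * (z i + 1) := by field_simp
    constructor <;> nlinarith [mul_le_mul_of_nonneg_left h5 hs.le,
      mul_le_mul_of_nonneg_left h6 hs.le]
  obtain ⟨k₀, hk₀, hUk₀⟩ := h0.1
  have hpt : ∀ {z k}, GoodSite E δ (y, fun k => (W k ∩ strip δ).Nonempty) z → k ∈ block N 2 z →
      δ ≤ E.U k y → (localPoints E Γ k (W k) y).Nonempty :=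
    fun hgood hk hU => localPoints_nonempty hU (hgood.2 _ hk)
  obtain ⟨x₀, hx₀⟩ := hpt h0 (block_mono (by norm_num) 0 hk₀) hUk₀
  have hchain : GoodSite E δ (y, fun k => (W k ∩ strip δ).Nonempty) z ∧
      ∃ k ∈ block N 0 z, δ ≤ E.U k y ∧ ∃ x ∈ localPoints E Γ k (W k) y,
      Relation.ReflTransGen (fun a c => c ∈ coxPoints E Γ W y ∧ dist a c < 1) x₀ x := by
    clear hi
    induction hz with
    | refl => exact ⟨h0, k₀, hk₀, hUk₀, x₀, hx₀, .refl⟩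
    | @tail a b _ hab ih =>
      obtain ⟨ha, k, hk, hUk, x, hx, hxx⟩ := ih
      have hb := goodField_eq_true.1 hab.2
      obtain ⟨k', hk', hUk'⟩ := hb.1
      refine ⟨hb, k', hk', hUk', ?_⟩
      -- Lattice neighbours differ by at most `1` in each coordinate, so the cell of `b` lies in
      -- `I_b^+(a)` and essential connectedness applies around `a`.
      have hk'1 : k' ∈ block N 1 a := by
        intro j
        have h1 : |a j - b j| ≤ 1 := by
          have h2 : ∑ i, |a i - b i| = 1 := hab.1
          rw [← h2]
          exact Finset.single_le_sum (f := fun i => |a i - b i|) (fun i _ => abs_nonneg _)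
            (Finset.mem_univ j)
        have h3 := abs_le.1 h1
        obtain ⟨h4, h5⟩ := hk' j
        constructor <;> nlinarith
      have hpath := hconn a k (block_mono (by norm_num) a hk) k' hk'1 (hδ.trans_le hUk)
        (hδ.trans_le hUk')
      have hlift : ∀ {c}, Relation.ReflTransGen
          (fun u c => SiteAdj u c ∧ (c = k' ∨ (η ≤ E.U c y ∧ c ∈ block N 2 a))) k c →
          ∃ x ∈ localPoints E Γ c (W c) y,
            Relation.ReflTransGen (fun a c => c ∈ coxPoints E Γ W y ∧ dist a c < 1) x₀ x := by
        intro c hc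
        induction hc with
        | refl => exact ⟨x, hx, hxx⟩
        | @tail u v _ huv ih =>
          obtain ⟨p, hp, hxp⟩ := ih
          -- Every site on the chain after `k` lies in `I_b^{++}(a)` and has mass at least `δ`:
          -- interior sites because `δ ≤ η`, the end site by choice. Goodness of `a` alone thus puts
          -- a Cox point in each cube.
          obtain ⟨q, hq⟩ : (localPoints E Γ v (W v) y).Nonempty := by
            rcases huv.2 with rfl | ⟨hv, hva⟩
            · exact hpt ha (block_mono (by norm_num) a hk'1) hUk'
            · exact hpt ha hva (hδη.trans hv)
          exact ⟨q, hq, hxp.tail ⟨mem_iUnion.2 ⟨v, hq⟩, dist_lt_one_of_siteAdj hd hM hN huv.1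
            (mem_cube_of_mem_localPoints hp) (mem_cube_of_mem_localPoints hq)⟩⟩
      exact hlift hpath
  obtain ⟨-, k, hk, -, x, hx, hxx⟩ := hchain
  obtain ⟨-, hjoin⟩ := joinedIn_of_chain (mem_iUnion.2 ⟨k₀, hx₀⟩) hxx
  have hx₀box : ∀ r, M ≤ r → x₀ ∈ box d r := by
    intro r hr j
    have := hcell hk₀ (mem_cube_of_mem_localPoints hx₀) j
    simp only [Pi.zero_apply, Int.cast_zero] at this
    rw [abs_le]
    constructor <;> linarith
  -- The cell of `z` spans `M * z i` to `M * (z i + 1)`, so `|z i| > n` gives `|x i| > M * n - M` at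
  -- least, which is beyond `n - 2 * M` because `M ≥ 1`.
  have hxbox : x ∉ box d (n - 2 * M) := by
    intro hbox
    have h1 := abs_le.1 (hbox i)
    obtain ⟨h2, h3⟩ := hcell hk (mem_cube_of_mem_localPoints hx) i
    have hi' : (n : ℝ) < |(z i : ℝ)| := by
      have : (n : ℤ) < |z i| := by simpa using hi
      exact_mod_cast this
    rcases lt_abs.1 hi' with h | h <;> nlinarith
  obtain ⟨q, hq, hxq⟩ := exists_joinedIn_boxBoundary (M := M) (r := n) (by linarith)
    (by linarith) hjoin (hx₀box _ (by linarith)) hxbox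
  exact ⟨x₀, hx₀box _ (by linarith), q, hq, hxq⟩

end Crossing

/-! ### From percolation of good sites to `θ > 0`, and the choice of parameters. -/

section Supercritical

variable {d : ℕ} {M : ℝ} {N : ℕ} {S : Type*} [MeasurableSpace S]
  {E : FactorEnvironment d M N S} {Γ : baseCube d (M / N) ≃ᵐ unitInterval}
  {Ω : Type*} [MeasurableSpace Ω] {P : Measure Ω} [IsProbabilityMeasure P]
  {Y : (Fin d → ℤ) → Ω → S} {V : (Fin d → ℤ) → Ω → Set (unitInterval × ℝ≥0)} {l : ℝ≥0}

/-- Almost sure percolation of the good sites forces `θ > 0`. -/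
theorem theta_pos (hd : 1 ≤ d) (hM : 1 ≤ M) (hN : 2 * (d : ℝ) * M < N)
    (hY : ∀ z, Measurable (Y z)) (hYindep : iIndepFun Y P)
    (hYident : ∀ z, IdentDistrib (Y z) (Y 0) P P)
    (hV : ∀ k, IsPoissonProcess (V k) (l • markVolume) P)
    (hVindep : iIndep (fun k => processSigma (V k)) P)
    (hVY : Indep (⨆ k, processSigma (V k)) (⨆ z, MeasurableSpace.comap (Y z) inferInstance) P)
    (h1 : E.OneDependent) {δ η : ℝ≥0} (hδ : 0 < δ) (hδη : δ ≤ η)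
    (h4 : ∀ᵐ ω ∂P, ∀ z, ∀ k ∈ block N 1 z, ∀ k' ∈ block N 1 z,
      0 < E.U k (fun z => Y z ω) → 0 < E.U k' (fun z => Y z ω) →
      Relation.ReflTransGen
        (fun a c => SiteAdj a c ∧ (c = k' ∨ (η ≤ E.U c (fun z => Y z ω) ∧ c ∈ block N 2 z))) k k')
    {q : ℝ} (hq : ForcesPercolation d q)
    (hgood : q ≤ P.real {ω | GoodSite E δ (drivingField Y V δ ω) 0}) :
    0 < theta E Γ P Y V := by
  have hd' : (1 : ℝ) ≤ d := by exact_mod_cast hd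
  have hN0 : 0 < N := by
    have : (0 : ℝ) < N := by nlinarith
    exact_mod_cast this
  have hD : Measurable (drivingField Y V δ) := measurable_drivingField hY hV
  have hF : Measurable fun ω => goodField E δ (drivingField Y V δ ω) :=
    measurable_goodField.comp hD
  -- Stationarity of the good field is used twice: to make all marginals equal to that at the
  -- origin, and to move a percolating site `z` to the origin.
  have hshift : ∀ (z : Fin d → ℤ) (s : Set ((Fin d → ℤ) → Bool)), MeasurableSet s →
      P {ω | (fun w => goodField E δ (drivingField Y V δ ω) (w + z)) ∈ s} =
        P {ω | goodField E δ (drivingField Y V δ ω) ∈ s} := by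
    intro z s hs
    have hDz : Measurable fun ω => ((fun w => (drivingField Y V δ ω).1 (w + z),
        fun k => (drivingField Y V δ ω).2 fun i => k i + N * z i) :
          ((Fin d → ℤ) → S) × ((Fin d → ℤ) → Prop)) := by
      refine (measurable_pi_iff.2 fun w => ?_).prodMk (measurable_pi_iff.2 fun k => ?_)
      · exact (measurable_pi_apply _).comp (measurable_fst.comp hD)
      · exact (measurable_pi_apply _).comp (measurable_snd.comp hD)
    have e := congrArg (fun μ => μ (goodField E δ ⁻¹' s)) (map_drivingField_shift (N := N) (δ := δ)
      hY hYindep hYident hV hVindep hVY z)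
    rw [Measure.map_apply hDz (measurable_goodField hs),
      Measure.map_apply hD (measurable_goodField hs)] at e
    refine Eq.trans (congrArg P ?_) e
    ext ω
    have hfun : (fun w => goodField E δ (drivingField Y V δ ω) (w + z)) =
        goodField E δ (fun w => (drivingField Y V δ ω).1 (w + z),
          fun k => (drivingField Y V δ ω).2 fun i => k i + N * z i) := by
      funext w
      exact (goodField_shift _ w z).symm
    change (fun w => goodField E δ (drivingField Y V δ ω) (w + z)) ∈ s ↔ goodField E δ _ ∈ s
    rw [hfun]
  set μ := P.map fun ω => goodField E δ (drivingField Y V δ ω) with hμ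
  have hμprob : IsProbabilityMeasure μ := Measure.isProbabilityMeasure_map hF.aemeasurable
  have hmarg : ∀ z, q ≤ μ.real {ω | ω z = true} := by
    intro z
    have e : μ {ω | ω z = true} = P {ω | GoodSite E δ (drivingField Y V δ ω) 0} := by
      rw [hμ, Measure.map_apply hF (measurableSet_apply_eq_true z)]
      have h := hshift z {c | c 0 = true} (measurableSet_apply_eq_true 0)
      simp only [mem_ofPred_eq, zero_add, goodField_eq_true] at h
      rw [← h]
      simp only [preimage_ofPred_eq, goodField_eq_true]
    rw [measureReal_def, e]
    exact hgood
  have hperc := hq μ hμprob (isDependent_goodField hY hN0 hYindep hV hVindep hVY h1) hmarg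
  -- Almost sure percolation is covered by countably many such events, so they cannot all be null.
  -- The probability found here bounds every late crossing probability from below.
  obtain ⟨z, hz⟩ : ∃ z, μ (⋂ m, reachSet m z) ≠ 0 := by
    by_contra hc
    push Not at hc
    have hall : ∀ᵐ c ∂μ, False := by
      have hnull : ∀ᵐ c ∂μ, ∀ z, c ∉ ⋂ m, reachSet m z :=
        ae_all_iff.2 fun z => measure_eq_zero_iff_ae_notMem.1 (hc z)
      filter_upwards [hperc, hnull] with c hc1 hc2
      obtain ⟨z, hz⟩ := hc1.exists_forall_mem_reachSet
      exact hc2 z (mem_iInter.2 hz)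
    exact hμprob.ne_zero _ (by simpa using hall)
  refine lt_of_lt_of_le (pos_iff_ne_zero.2 hz)
    (ge_of_tendsto (tendsto_crossingProb E Γ P Y V (by linarith)) ?_)
  obtain ⟨n₀, hn₀⟩ := exists_nat_ge (5 * M)
  filter_upwards [eventually_ge_atTop n₀] with n hn
  calc μ (⋂ m, reachSet m z) ≤ μ (reachSet n z) := measure_mono (iInter_subset _ n)
    _ = P {ω | goodField E δ (drivingField Y V δ ω) ∈ reachSet n z} :=
        Measure.map_apply hF (measurableSet_reachSet n z)
    _ ≤ P {ω | (fun w => goodField E δ (drivingField Y V δ ω) (w + z)) ∈ reachSet n 0} :=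
        measure_mono fun ω hω => mem_reachSet_shift hω
    _ = P {ω | goodField E δ (drivingField Y V δ ω) ∈ reachSet n 0} :=
        hshift z _ (measurableSet_reachSet n 0)
    _ ≤ crossingProb E Γ P Y V n := by
        refine measure_mono_ae ?_
        filter_upwards [h4] with ω hω hreach
        exact connects_of_mem_reachSet hd hM hN hδ hδη hω
          (hn₀.trans (by exact_mod_cast hn)) hreach

/-- The probability that the origin is good, at high intensity. -/
theorem le_measureReal_goodSite
    (hV : ∀ k, IsPoissonProcess (V k) (l • markVolume) P) (δ : ℝ≥0) :
    P.real {ω | ∃ k ∈ block N 0 (0 : Fin d → ℤ), δ ≤ E.U k (fun z => Y z ω)} -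
      (block_finite (N := N) 2 (0 : Fin d → ℤ)).toFinset.card * Real.exp (-(l * δ)) ≤
      P.real {ω | GoodSite E δ (drivingField Y V δ ω) 0} := by
  set T := (block_finite (N := N) 2 (0 : Fin d → ℤ)).toFinset with hT
  -- Given a `δ`-supported site in the cell, goodness fails only if one of the finitely many strips
  -- over `I_b^{++}(0)` is vacant; a union bound follows.
  have hsub : {ω | ∃ k ∈ block N 0 (0 : Fin d → ℤ), δ ≤ E.U k (fun z => Y z ω)} ⊆
      {ω | GoodSite E δ (drivingField Y V δ ω) 0} ∪
        ⋃ k ∈ T, {ω | (V k ω ∩ strip δ).Nonempty}ᶜ := by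
    intro ω hω
    by_cases hocc : ∀ k ∈ block N 2 (0 : Fin d → ℤ), (V k ω ∩ strip δ).Nonempty
    · exact Or.inl ⟨hω, hocc⟩
    · push Not at hocc
      obtain ⟨k, hk, hke⟩ := hocc
      refine Or.inr (mem_iUnion₂.2 ⟨k, by simpa [hT] using hk, ?_⟩)
      exact not_nonempty_iff_eq_empty.2 hke
  have hsum : P.real (⋃ k ∈ T, {ω | (V k ω ∩ strip δ).Nonempty}ᶜ) ≤
      T.card * Real.exp (-(l * δ)) := by
    refine (measureReal_biUnion_finset_le _ _).trans ?_
    rw [← nsmul_eq_mul]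
    refine Finset.sum_le_card_nsmul _ _ _ fun k _ => ?_
    rw [measureReal_def, (hV k).measure_strip_empty, ENNReal.toReal_ofReal (Real.exp_pos _).le]
  have := (measureReal_mono (μ := P) hsub).trans (measureReal_union_le _ _)
  linarith

/-- The coverage probability is approximated by that of `δ`-supported sites. -/
theorem exists_lt_measureReal_supported {q : ℝ}
    (hq : q < P.real {ω | ∃ k ∈ block N 0 (0 : Fin d → ℤ), 0 < E.U k (fun z => Y z ω)})
    {η : ℝ≥0} (hη : 0 < η) : ∃ δ : ℝ≥0, 0 < δ ∧ δ ≤ η ∧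
      q < P.real {ω | ∃ k ∈ block N 0 (0 : Fin d → ℤ), δ ≤ E.U k (fun z => Y z ω)} := by
  -- As these heights decrease to `0` the supported events increase to the non-empty event, so
  -- continuity from below applies; the first height is `η`, which keeps `δ ≤ η`.
  let δ : ℕ → ℝ≥0 := fun n => η / (n + 1)
  have hδ0 : ∀ n, 0 < δ n := fun n => by positivity
  have hδη : ∀ n, δ n ≤ η := fun n => div_le_self zero_le (by simp)
  have hδanti : Antitone δ := fun a b hab => by
    have : (a : ℝ≥0) ≤ b := by exact_mod_cast hab
    exact div_le_div_of_nonneg_left zero_le (by positivity) (by gcongr)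
  let A : ℕ → Set Ω := fun n => {ω | ∃ k ∈ block N 0 (0 : Fin d → ℤ), δ n ≤ E.U k (fun z => Y z ω)}
  have hA : Monotone A := fun a b hab ω ⟨k, hk, h⟩ => ⟨k, hk, (hδanti hab).trans h⟩
  have hunion : {ω | ∃ k ∈ block N 0 (0 : Fin d → ℤ), 0 < E.U k (fun z => Y z ω)} = ⋃ n, A n := by
    ext ω
    simp only [A, mem_iUnion, mem_ofPred_eq]
    constructor
    · rintro ⟨k, hk, h⟩
      obtain ⟨n, hn⟩ := exists_nat_gt (η / E.U k fun z => Y z ω)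
      refine ⟨n, k, hk, ?_⟩
      rw [div_lt_iff₀ h] at hn
      refine div_le_of_le_mul₀ zero_le zero_le ?_
      calc η ≤ n * E.U k fun z => Y z ω := hn.le
        _ ≤ (E.U k fun z => Y z ω) * (n + 1) := by
          rw [mul_comm]; gcongr; simp
    · rintro ⟨n, k, hk, h⟩
      exact ⟨k, hk, (hδ0 n).trans_le h⟩
  have hlim : Tendsto (fun n => P.real (A n)) atTop (𝓝 (P.real (⋃ n, A n))) :=
    (ENNReal.tendsto_toReal (measure_ne_top P _)).comp (tendsto_measure_iUnion_atTop hA)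
  rw [hunion] at hq
  obtain ⟨n, hn⟩ := (hlim.eventually (lt_mem_nhds hq)).exists
  exact ⟨δ n, hδ0 n, hδη n, hn⟩

end Supercritical

end CoxPercolation

theorem proposition3p1 {d : ℕ} (hd : 1 ≤ d) {M : ℝ} (hM : 1 ≤ M) {N : ℕ}
    (hN : 2 * (d : ℝ) * M < N)
    (Γ : baseCube d (M / N) ≃ᵐ unitInterval)
    {S : Type*} [MeasurableSpace S] (E : FactorEnvironment d M N S)
    {Ω : Type*} [MeasurableSpace Ω] (P : Measure Ω) [IsProbabilityMeasure P]
    -- the iid family `Y` behind the environment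
    (Y : (Fin d → ℤ) → Ω → S) (hY : ∀ z, Measurable (Y z)) (hYindep : iIndepFun Y P)
    (hYident : ∀ z, IdentDistrib (Y z) (Y 0) P P)
    -- for every `l > 0`, an iid family `V l` of Poisson point processes on `[0, 1] × [0, ∞)`
    -- with intensity `l`, independent of `Y`
    (V : ℝ≥0 → (Fin d → ℤ) → Ω → Set (unitInterval × ℝ≥0))
    (hV : ∀ l, 0 < l → ∀ k, IsPoissonProcess (V l k) (l • markVolume) P)
    (hVindep : ∀ l, 0 < l → iIndep (fun k => processSigma (V l k)) P)
    (hVY : ∀ l, 0 < l → Indep (⨆ k, processSigma (V l k))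
      (⨆ z, MeasurableSpace.comap (Y z) inferInstance) P)
    -- the conditions on the environment
    (h1 : E.OneDependent) (h2 : E.BoundedIntensity P Y) (h3 : E.Coverage P Y)
    (h4 : E.EssentiallyConnected P Y) :
    (∀ l : ℝ≥0, 0 < l →
      Tendsto (crossingProb E Γ P Y (V l)) atTop (𝓝 (theta E Γ P Y (V l)))) ∧
    0 < criticalIntensity E Γ P Y V ∧ criticalIntensity E Γ P Y V < ∞ := by
  have hd' : (1 : ℝ) ≤ d := by exact_mod_cast hd
  have hMN : M ≤ N := by nlinarith
  refine ⟨fun l _ => tendsto_crossingProb E Γ P Y (V l) (by linarith), ?_, ?_⟩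
  · obtain ⟨ρ, hρ0, hρ⟩ := h2
    set K : ℕ := (2 * (N + 1) + 1) ^ d with hK
    have hK0 : (0 : ℝ≥0) < K := by
      have : 0 < K := by positivity
      exact_mod_cast this
    -- This is the largest intensity with `K * (l * ρ) ≤ 1 / 2`, the condition under which the chain
    -- count is beaten.
    let l₀ : ℝ≥0 := 1 / 2 / (K * ρ)
    have hl₀ : 0 < l₀ := by positivity
    refine lt_of_lt_of_le (ENNReal.coe_pos.2 hl₀) (le_sInf ?_)
    rintro _ ⟨l, hl, hθ, rfl⟩
    by_contra hc
    have hll₀ : l ≤ l₀ := by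
      rw [not_le] at hc
      exact_mod_cast hc.le
    refine hθ.ne' (theta_eq_zero hM hMN (hV l hl) (hVindep l hl) hρ ?_)
    calc (K : ℝ≥0) * (l * ρ) = l * (K * ρ) := by ring
      _ ≤ l₀ * (K * ρ) := by gcongr
      _ = 1 / 2 := div_mul_cancel₀ _ (by positivity)
  · obtain ⟨η, hη, hconn⟩ := h4
    obtain ⟨q, hqp, hq⟩ := exists_forcesPercolation_lt hd h3
    obtain ⟨δ, hδ, hδη, hqδ⟩ := exists_lt_measureReal_supported hqp hη
    set p := P.real {ω | ∃ k ∈ block N 0 (0 : Fin d → ℤ), δ ≤ E.U k (fun z => Y z ω)} with hp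
    set C : ℝ := ((block_finite (N := N) 2 (0 : Fin d → ℤ)).toFinset.card : ℝ) with hC
    -- With `δ` fixed beforehand, the cost of vacant strips vanishes as the intensity grows, so it
    -- eventually drops below the gap `p - q`.
    have hlim : Tendsto (fun t : ℝ => C * Real.exp (-(t * δ))) atTop (𝓝 (C * 0)) := by
      refine Tendsto.const_mul _ (Real.tendsto_exp_neg_atTop_nhds_zero.comp ?_)
      exact tendsto_id.atTop_mul_const (by exact_mod_cast hδ)
    rw [mul_zero] at hlim
    obtain ⟨t, htlt, ht0⟩ := ((hlim.eventually (gt_mem_nhds (sub_pos.2 hqδ))).and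
      (eventually_gt_atTop 0)).exists
    let l : ℝ≥0 := ⟨t, ht0.le⟩
    have hl : 0 < l := ht0
    have hgood := le_measureReal_goodSite (E := E) (Y := Y) (hV l hl) δ
    have hθ : 0 < theta E Γ P Y (V l) := by
      refine theta_pos hd hM hN hY hYindep hYident (hV l hl) (hVindep l hl) (hVY l hl) h1 hδ hδη
        hconn hq (le_trans ?_ hgood)
      have : (l : ℝ) = t := rfl
      rw [this, ← hp, ← hC]
      linarith
    exact lt_of_le_of_lt (sInf_le ⟨l, hl, hθ, rfl⟩) ENNReal.coe_lt_top
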